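/- Fix an integer $n\ge 3$. A \emph{generalized $n$-gon} is a bipartite graph of diameter $n$ and girth $2n$ in which every vertex has valency at least $3$. A \emph{clean arc} in a graph $H$ consists of the inner vertices $x_1,\dots,x_{n-2}$ of a path $(x_0,x_1,\dots,x_{n-1})$ in $H$ (without repeated vertices) such that each of $x_1,\dots,x_{n-2}$ has valency $2$ in $H$; a \emph{loose end} of $H$ is a vertex of valency at most $1$ in $H$. A generalized $n$-gon is \emph{open} if every nonempty finite (induced) subgraph of it contains a loose end or a clean arc. Let $T_n$ be the theory of open generalized $n$-gons, i.e. the set of all first-order sentences that hold in every open generalized $n$-gon, in the language of graphs expanded by two unary predicates for the two classes of the bipartition. Then $T_n$ is not model complete (not every embedding between models of $T_n$ is elementary), and $T_n$ does not have quantifier elimination (not every formula is equivalent modulo $T_n$ to a quantifier-free formula in the same free variables). -/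

import Mathlib

open FirstOrder

/-! ### Generalized polygons -/

namespace SimpleGraph

variable {V : Type*}

/-- A generalized `n`-gon: a bipartite graph of diameter `n` and girth `2 * n` in which every
vertex has valency at least `3`. -/
structure IsGeneralizedPolygon (G : SimpleGraph V) (n : ℕ) : Prop where
  bipartite : G.IsBipartite
  ediam_eq : G.ediam = (n : ℕ∞)
  egirth_eq : G.egirth = ((2 * n : ℕ) : ℕ∞)
  thick : ∀ v : V, 3 ≤ (G.neighborSet v).encard

/-- A loose end is a vertex of valency at most `1`. -/
def HasLooseEnd (H : SimpleGraph V) : Prop :=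
  ∃ v : V, (H.neighborSet v).encard ≤ 1

/-- `H` contains a clean arc: a path `x 0, x 1, …, x (n - 1)` (without repeated vertices) such that
`x 1, …, x (n - 2)` have valency `2` in `H`. -/
def HasCleanArc (H : SimpleGraph V) (n : ℕ) : Prop :=
  ∃ x : ℕ → V, Set.InjOn x (Set.Iio n) ∧
    (∀ i, i + 1 < n → H.Adj (x i) (x (i + 1))) ∧
    (∀ i, 0 < i → i + 1 < n → (H.neighborSet (x i)).encard = 2)

/-- `G` is open (with respect to `n`): every nonempty finite subgraph contains a loose end or a
clean arc, where valencies are computed in the subgraph. -/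
def IsOpenPolygon (G : SimpleGraph V) (n : ℕ) : Prop :=
  ∀ s : Set V, s.Finite → s.Nonempty →
    (G.induce s).HasLooseEnd ∨ (G.induce s).HasCleanArc n

end SimpleGraph

/-! ### Model completeness and quantifier elimination -/

namespace FirstOrder.Language

universe u v

/-- An embedding is elementary if it preserves and reflects the truth of all first-order
formulas. -/
def Embedding.IsElementary {L : FirstOrder.Language.{u, v}} {M N : Type*} [L.Structure M] [L.Structure N]
    (f : M ↪[L] N) : Prop :=
  ∀ (k : ℕ) (φ : L.Formula (Fin k)) (x : Fin k → M), φ.Realize (f ∘ x) ↔ φ.Realize x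

/-- A theory is model complete if all embeddings between its models are elementary. -/
def Theory.IsModelComplete {L : FirstOrder.Language.{u, v}} (T : L.Theory) : Prop :=
  ∀ (M N : Theory.ModelType.{u, v, max u v} T) (f : M ↪[L] N), f.IsElementary

/-- A theory has quantifier elimination if every formula is equivalent modulo the theory to a
quantifier-free formula in the same free variables. -/
def Theory.HasQuantifierElimination {L : FirstOrder.Language.{u, v}} (T : L.Theory) : Prop :=
  ∀ (k : ℕ) (φ : L.Formula (Fin k)),
    ∃ ψ : L.Formula (Fin k), BoundedFormula.IsQF ψ ∧ T ⊨ᵇ φ.iff ψ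

end FirstOrder.Language

/-! ### The theory of open generalized polygons -/

namespace OpenPolygon

open FirstOrder.Language FirstOrder.Language.Structure

/-- Relation symbols: adjacency and one predicate for each of the two bipartition classes. -/
inductive Rel : ℕ → Type
  | point : Rel 1
  | line : Rel 1
  | adj : Rel 2

/-- The language of graphs expanded by two predicates for the bipartition. -/
def lang : FirstOrder.Language.{0, 0} := ⟨fun _ => Empty, Rel⟩

/-- The symbol for the first class of the bipartition. -/
def pointSymb : lang.Relations 1 := Rel.point

/-- The symbol for the second class of the bipartition. -/
def lineSymb : lang.Relations 1 := Rel.line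

/-- The symbol for adjacency. -/
def adjSymb : lang.Relations 2 := Rel.adj

/-- The structure `M` is an open generalized `n`-gon, with the two predicates interpreted as the
classes of its bipartition. -/
def IsOpenGeneralizedPolygon (n : ℕ) (M : Type*) [lang.Structure M] : Prop :=
  ∃ G : SimpleGraph M,
    (∀ a b : M, G.Adj a b ↔ RelMap adjSymb ![a, b]) ∧
    G.IsBipartiteWith {a : M | RelMap pointSymb ![a]} {a : M | RelMap lineSymb ![a]} ∧
    G.IsGeneralizedPolygon n ∧ G.IsOpenPolygon n

/-- The theory of open generalized `n`-gons: all sentences that hold in every open generalized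
`n`-gon. -/
def theory (n : ℕ) : lang.Theory :=
  {φ : lang.Sentence | ∀ (M : Type) [lang.Structure M], IsOpenGeneralizedPolygon n M → M ⊨ φ}

end OpenPolygon

/-! Put m = n - 2. The witness is an inclusion G ⊆ H of open generalized n-gons and six vertices x_i
of G such that H, but not G, contains a closed hexagon with sides of length m, disjoint from the
x_i, whose i-th corner is adjacent to x_i. The existence of such a hexagon is a first-order formula
in the x_i, so the inclusion is not elementary. As embeddings preserve and reflect quantifier-free
formulas, this formula is not equivalent to one.

Both graphs are free completions (`exists_completion`): in a bipartite graph of girth at least 2n,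
vertices of suitable parity that are too far apart are repeatedly joined by new paths of length n -
1. G completes a hexagon with sides of length n and corners x_i; H completes G with the small
hexagon attached. Attaching it keeps the girth at least 2n (`attachHexagon_coreBound`).

Openness is handled through the relative, transitive notion `HyperfreeOver`. G is hyperfree over the
x_i, since the long sides contain clean arcs avoiding the corners. But the small hexagon together
with the x_i has no loose end or clean arc outside the x_i: its corners have valency 3 and its sides
only n - 3 inner vertices. So it does not occur in G (`HyperfreeOver.not_hasHexagon`). Still, H is
open, because it can be built in another order: the small hexagon alone has a clean arc through a
corner, the x_i are loose ends over it, and the rest of G is hyperfree over the x_i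
(`attachHexagon_hyperfreeOver_empty`). -/

namespace SimpleGraph

/-! ### Relative openness, cores and girth -/

variable {V W : Type*}

/-- A finite set of vertices is a core if each of its vertices has two neighbours in it. -/
def IsCore (G : SimpleGraph V) (s : Finset V) : Prop :=
  ∀ y ∈ s, ∃ a ∈ s, ∃ b ∈ s, a ≠ b ∧ G.Adj y a ∧ G.Adj y b

/-- Every nonempty core has at least `k` vertices; equivalently, the girth is at least `k`. -/
def CoreBound (G : SimpleGraph V) (k : ℕ) : Prop :=
  ∀ s : Finset V, s.Nonempty → G.IsCore s → k ≤ s.card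

/-- Every finite subset of `Y` not contained in `X` contains a loose end outside `X` or a clean arc
whose inner vertices are outside `X`. -/
def HyperfreeOver (G : SimpleGraph V) (n : ℕ) (X Y : Set V) : Prop :=
  ∀ s : Set V, s.Finite → s ⊆ Y → (s \ X).Nonempty →
    (∃ y ∈ s \ X, ∀ a ∈ s, ∀ b ∈ s, G.Adj y a → G.Adj y b → a = b) ∨
    ∃ x : ℕ → V, Set.InjOn x (Set.Iio n) ∧ (∀ i < n, x i ∈ s) ∧
      (∀ i, i + 1 < n → G.Adj (x i) (x (i + 1))) ∧
      ∀ i, 0 < i → i + 1 < n →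
        x i ∉ X ∧ ∀ z ∈ s, G.Adj (x i) z → z = x (i - 1) ∨ z = x (i + 1)

/-- A subset of `Z` either lies in `Y` or meets `Z \ Y`; in the second case the loose end or arc
found avoids `Y`, hence `X`. Openness can thus be checked along a chain of free steps. -/
theorem HyperfreeOver.trans {G : SimpleGraph V} {n : ℕ} {X Y Z : Set V}
    (h₁ : G.HyperfreeOver n X Y) (h₂ : G.HyperfreeOver n Y Z) (hXY : X ⊆ Y) :
    G.HyperfreeOver n X Z := by
  intro s hs hsZ hsX
  by_cases hsY : s ⊆ Y
  · exact h₁ s hs hsY hsX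
  · obtain ⟨y, hy, hyY⟩ := Set.not_subset.1 hsY
    rcases h₂ s hs hsZ ⟨y, hy, hyY⟩ with ⟨y, hy, h⟩ | ⟨x, hinj, hmem, hadj, hx⟩
    · exact Or.inl ⟨y, ⟨hy.1, fun h' => hy.2 (hXY h')⟩, h⟩
    · exact Or.inr ⟨x, hinj, hmem, hadj, fun i hi hin =>
        ⟨fun h' => (hx i hi hin).1 (hXY h'), (hx i hi hin).2⟩⟩

theorem HyperfreeOver.image {G : SimpleGraph V} {H : SimpleGraph W} {n : ℕ} {X Y : Set V}
    (h : G.HyperfreeOver n X Y) (e : G ↪g H) : H.HyperfreeOver n (e '' X) (e '' Y) := by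
  intro s hs hsY hsX
  have hsur : ∀ z ∈ s, ∃ y ∈ Y, e y = z := fun z hz => hsY hz
  have hX : ∀ y, e y ∈ e '' X ↔ y ∈ X := fun y => e.injective.mem_set_image
  have hs' : (e ⁻¹' s).Finite := hs.preimage e.injective.injOn
  have h1 : e ⁻¹' s ⊆ Y := by
    intro y hy
    obtain ⟨y', hy', he⟩ := hsur _ hy
    rwa [← e.injective he]
  have h2 : (e ⁻¹' s \ X).Nonempty := by
    obtain ⟨z, hz, hzX⟩ := hsX
    obtain ⟨y, hy, rfl⟩ := hsur _ hz
    exact ⟨y, hz, fun h' => hzX ((hX y).2 h')⟩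
  rcases h _ hs' h1 h2 with ⟨y, hy, hl⟩ | ⟨x, hinj, hmem, hadj, hx⟩
  · refine Or.inl ⟨e y, ⟨hy.1, fun h' => hy.2 ((hX y).1 h')⟩, ?_⟩
    intro a ha b hb hya hyb
    obtain ⟨a, -, rfl⟩ := hsur _ ha
    obtain ⟨b, -, rfl⟩ := hsur _ hb
    rw [hl a ha b hb (e.map_adj_iff.1 hya) (e.map_adj_iff.1 hyb)]
  · refine Or.inr ⟨e ∘ x, e.injective.comp_injOn hinj, hmem,
      fun i hi => e.map_adj_iff.2 (hadj i hi), fun i hi hin =>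
        ⟨fun h' => (hx i hi hin).1 ((hX _).1 h'), ?_⟩⟩
    intro z hz hz'
    obtain ⟨z, -, rfl⟩ := hsur _ hz
    exact ((hx i hi hin).2 z hz (e.map_adj_iff.1 hz')).imp (congrArg e) (congrArg e)

theorem forall_mem_of_forall_interior {s : Set V} {p : ℕ → V} {N i₀ : ℕ}
    (h : ∀ i, 0 < i → i < N → p i ∈ s → p (i - 1) ∈ s ∧ p (i + 1) ∈ s)
    (h0 : 0 < i₀) (hN : i₀ < N) (hp : p i₀ ∈ s) : ∀ j ≤ N, p j ∈ s := by
  have up : ∀ d, i₀ + d ≤ N → p (i₀ + d) ∈ s := by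
    intro d
    induction d with
    | zero => intro _; exact hp
    | succ d ih => intro hd; exact (h (i₀ + d) (by omega) (by omega) (ih (by omega))).2
  have down : ∀ d, d ≤ i₀ → p (i₀ - d) ∈ s := by
    intro d
    induction d with
    | zero => intro _; exact hp
    | succ d ih => intro hd; exact (h (i₀ - d) (by omega) (by omega) (ih (by omega))).1
  intro j hj
  rcases le_total i₀ j with hij | hij
  · simpa [Nat.add_sub_cancel' hij] using up (j - i₀) (by omega)
  · simpa [Nat.sub_sub_self hij] using down (i₀ - j) (by omega)

/-- If a vertex of a finite set with at least two neighbours in the set has all its neighbours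
among two given ones, then these two belong to the set. -/
theorem mem_and_mem_of_two_neighbors {G : SimpleGraph V} {s : Set V} {y c d : V}
    (h : ∃ a ∈ s, ∃ b ∈ s, a ≠ b ∧ G.Adj y a ∧ G.Adj y b)
    (hy : ∀ z, G.Adj y z → z = c ∨ z = d) : c ∈ s ∧ d ∈ s := by
  obtain ⟨a, ha, b, hb, hab, hya, hyb⟩ := h
  rcases hy a hya with rfl | rfl <;> rcases hy b hyb with rfl | rfl <;>
    first | exact absurd rfl hab | exact ⟨ha, hb⟩ | exact ⟨hb, ha⟩

/-- If `u` has a single neighbour, delete `u`: only that neighbour loses an edge, and it keeps at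
least one, so it is the next possible leaf. This ends when the exceptional vertex has two
neighbours. -/
theorem exists_core_of_one_leaf [DecidableEq V] (G : SimpleGraph V) :
    ∀ (k : ℕ) (C : Finset V), C.card = k → ∀ u ∈ C, (∃ a ∈ C, G.Adj u a) →
      (∀ y ∈ C, y ≠ u → ∃ a ∈ C, ∃ b ∈ C, a ≠ b ∧ G.Adj y a ∧ G.Adj y b) →
      ∃ t ⊆ C, t.Nonempty ∧ G.IsCore t := by
  intro k
  induction k with
  | zero => intro C hC u hu; simp [Finset.card_eq_zero.1 hC] at hu
  | succ k ih =>
    intro C hC u hu ⟨w, hw, huw⟩ hy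
    by_cases hu2 : ∃ a ∈ C, ∃ b ∈ C, a ≠ b ∧ G.Adj u a ∧ G.Adj u b
    · refine ⟨C, subset_rfl, ⟨u, hu⟩, fun y hyC => ?_⟩
      by_cases hyu : y = u
      · subst hyu; exact hu2
      · exact hy y hyC hyu
    · have huniq : ∀ a ∈ C, G.Adj u a → a = w := by
        intro a ha hua
        by_contra hne
        exact hu2 ⟨a, ha, w, hw, hne, hua, huw⟩
      obtain ⟨t, ht, hne, hcore⟩ := ih (C.erase u) (by rw [Finset.card_erase_of_mem hu, hC]; rfl) w
        (Finset.mem_erase.2 ⟨huw.ne', hw⟩)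
        (by
          obtain ⟨a, ha, b, hb, hab, hwa, hwb⟩ := hy w hw huw.ne'
          by_cases hau : a = u
          · exact ⟨b, Finset.mem_erase.2 ⟨fun h => hab (hau.trans h.symm), hb⟩, hwb⟩
          · exact ⟨a, Finset.mem_erase.2 ⟨hau, ha⟩, hwa⟩)
        (by
          intro y hyC hyw
          obtain ⟨hyu, hyC'⟩ := Finset.mem_erase.1 hyC
          obtain ⟨a, ha, b, hb, hab, hya, hyb⟩ := hy y hyC' hyu
          refine ⟨a, Finset.mem_erase.2 ⟨?_, ha⟩, b, Finset.mem_erase.2 ⟨?_, hb⟩, hab, hya, hyb⟩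
          · rintro rfl; exact hyw (huniq y hyC' hya.symm)
          · rintro rfl; exact hyw (huniq y hyC' hyb.symm))
      exact ⟨t, ht.trans (Finset.erase_subset _ _), hne, hcore⟩

/-- In a finite set of vertices in which all vertices but `u` and `v` have two neighbours, and `u`
has one, there is a core or a path from `u` to `v`. -/
theorem exists_core_or_walk (G : SimpleGraph V) (s : Finset V) {u v : V} (hu : u ∈ s)
    (hv : v ∈ s) (hu1 : ∃ a ∈ s, G.Adj u a)
    (hs : ∀ y ∈ s, y ≠ u → y ≠ v → ∃ a ∈ s, ∃ b ∈ s, a ≠ b ∧ G.Adj y a ∧ G.Adj y b) :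
    (∃ t ⊆ s, t.Nonempty ∧ G.IsCore t) ∨ ∃ p : G.Walk u v, p.length < s.card := by
  classical
  by_cases hr : (G.induce (s : Set V)).Reachable ⟨u, hu⟩ ⟨v, hv⟩
  · right
    obtain ⟨p, hp⟩ := hr.exists_isPath
    have hlt := hp.length_lt
    refine ⟨p.map (Embedding.induce (s : Set V)).toHom, ?_⟩
    exact (Walk.length_map _ p).trans_lt (by simpa using hlt)
  · left
    -- The part reachable from `u` is closed under adjacency within `s` and misses `v`, so `u` is
    -- its only possible leaf.
    let C := s.filter fun y => ∃ h : y ∈ s, (G.induce (s : Set V)).Reachable ⟨u, hu⟩ ⟨y, h⟩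
    have hC : ∀ y ∈ C, ∀ a ∈ s, G.Adj y a → a ∈ C := by
      intro y hy a ha hya
      obtain ⟨-, hys, hyr⟩ := Finset.mem_filter.1 hy
      refine Finset.mem_filter.2 ⟨ha, ha, hyr.trans ?_⟩
      exact Adj.reachable (G := G.induce (s : Set V)) (u := ⟨y, hys⟩) (v := ⟨a, ha⟩) hya
    have huC : u ∈ C := Finset.mem_filter.2 ⟨hu, hu, Reachable.refl _⟩
    have hvC : v ∉ C := fun h => by
      obtain ⟨_, _, h'⟩ := Finset.mem_filter.1 h
      exact hr h'
    obtain ⟨t, ht, h⟩ := exists_core_of_one_leaf G _ C rfl u huC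
      (by obtain ⟨a, ha, hua⟩ := hu1; exact ⟨a, hC u huC a ha hua, hua⟩)
      (by
        intro y hy hyu
        obtain ⟨a, ha, b, hb, hab, hya, hyb⟩ := hs y (Finset.mem_filter.1 hy).1 hyu
          (by rintro rfl; exact hvC hy)
        exact ⟨a, hC y hy a ha hya, b, hC y hy b hb hyb, hab, hya, hyb⟩)
    exact ⟨t, ht.trans (Finset.filter_subset _ _), h⟩

theorem Walk.IsCycle.isCore_support [DecidableEq V] {G : SimpleGraph V} {v : V} {c : G.Walk v v}
    (hc : c.IsCycle) : G.IsCore c.support.toFinset := by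
  intro y hy
  have hy' : y ∈ c.support := by simpa using hy
  have h2 := hc.ncard_neighborSet_toSubgraph_eq_two hy'
  obtain ⟨a, b, hab, he⟩ := Set.ncard_eq_two.1 h2
  have ha : c.toSubgraph.Adj y a := by
    have : a ∈ c.toSubgraph.neighborSet y := by rw [he]; simp
    exact this
  have hb : c.toSubgraph.Adj y b := by
    have : b ∈ c.toSubgraph.neighborSet y := by rw [he]; simp
    exact this
  exact ⟨a, by simpa using ha.snd_mem, b, by simpa using hb.snd_mem, hab,
    ha.adj_sub, hb.adj_sub⟩

theorem CoreBound.le_egirth {G : SimpleGraph V} {k : ℕ} (h : G.CoreBound k) : (k : ℕ∞) ≤ G.egirth := by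
  classical
  rw [SimpleGraph.le_egirth]
  intro v c hc
  have h1 := h _ ⟨v, by simp⟩ hc.isCore_support
  -- The base point recurs at the end of the cycle, so the tail lists all vertices with only
  -- `c.length` entries.
  have h2 : c.support.toFinset ⊆ c.support.tail.toFinset := by
    intro y hy
    rw [List.mem_toFinset] at hy ⊢
    rcases (Walk.mem_support_iff c).1 hy with rfl | h
    · exact Walk.end_mem_tail_support hc.not_nil
    · exact h
  have h3 := (Finset.card_le_card h2).trans (List.toFinset_card_le _)
  have h4 : c.support.tail.length = c.length := by simp
  exact_mod_cast h1.trans (h3.trans h4.le)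

/-- Two paths with the same ends whose total length is less than the girth have the same length. -/
theorem length_eq_of_isPath_of_lt_egirth {G : SimpleGraph V} {u v : V} {p q : G.Walk u v}
    (hp : p.IsPath) (hq : q.IsPath) (h : ((p.length + q.length : ℕ) : ℕ∞) < G.egirth) :
    p.length = q.length := by
  classical
  by_cases huv : u = v
  · subst huv
    rw [Walk.length_eq_zero_iff.2 (Walk.isPath_iff_nil.1 hp),
      Walk.length_eq_zero_iff.2 (Walk.isPath_iff_nil.1 hq)]
  -- The two supports share both ends, so their union has at most `p.length + q.length` vertices,
  -- too few for a cycle. In the resulting forest the two paths coincide.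
  let t : Finset V := p.support.toFinset ∪ q.support.toFinset
  have hcard : t.card ≤ p.length + q.length := by
    have h1 : t.card + (p.support.toFinset ∩ q.support.toFinset).card =
      p.support.toFinset.card + q.support.toFinset.card := Finset.card_union_add_card_inter _ _
    have h2 : p.support.toFinset.card ≤ p.length + 1 := by
      simpa using List.toFinset_card_le p.support
    have h3 : q.support.toFinset.card ≤ q.length + 1 := by
      simpa using List.toFinset_card_le q.support
    have h4 : ({u, v} : Finset V) ⊆ p.support.toFinset ∩ q.support.toFinset := by
      intro z hz
      rcases Finset.mem_insert.1 hz with rfl | hz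
      · simp
      · rw [Finset.mem_singleton.1 hz]; simp
    have h5 := Finset.card_le_card h4
    rw [Finset.card_pair huv] at h5
    omega
  have hac : (G.induce (t : Set V)).IsAcyclic := by
    intro w c hc
    have h1 := egirth_le_length (hc.map (f := (Embedding.induce (G := G) (t : Set V)).toHom)
      (Embedding.induce (G := G) (t : Set V)).injective)
    have h2 := hc.isPath_tail.length_lt
    have h3 := c.length_tail_add_one hc.not_nil
    rw [Walk.length_map] at h1
    have h4 : Fintype.card (t : Set V) = t.card := by simp
    have h5 : c.length ≤ p.length + q.length := by omega
    exact absurd (h1.trans (by exact_mod_cast h5)) (not_le.2 h)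
  have hpt : ∀ x ∈ p.support, x ∈ (t : Set V) := fun x hx => by simp [t, hx]
  have hqt : ∀ x ∈ q.support, x ∈ (t : Set V) := fun x hx => by simp [t, hx]
  have hp' : (p.induce (t : Set V) hpt).IsPath := by
    apply Walk.IsPath.of_map (f := (Embedding.induce (G := G) (t : Set V)).toHom)
    rw [Walk.map_induce]; exact hp
  have hq' : (q.induce (t : Set V) hqt).IsPath := by
    apply Walk.IsPath.of_map (f := (Embedding.induce (G := G) (t : Set V)).toHom)
    rw [Walk.map_induce]; exact hq
  have heq : p.induce (t : Set V) hpt = q.induce (t : Set V) hqt :=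
    congrArg Subtype.val ((hac.subsingleton_path _ _).elim ⟨_, hp'⟩ ⟨_, hq'⟩)
  have hl := congrArg (fun r => (Walk.map (Embedding.induce (G := G) (t : Set V)).toHom r).length) heq
  simp only [Walk.map_induce] at hl
  exact hl

/-- The walk along a sequence of vertices. -/
theorem exists_walk_of_forall_adj {G : SimpleGraph V} (p : ℕ → V) :
    ∀ N : ℕ, (∀ i < N, G.Adj (p i) (p (i + 1))) →
      ∃ w : G.Walk (p 0) (p N), w.length = N ∧ w.support = (List.range (N + 1)).map p := by
  intro N
  induction N with
  | zero => intro _; exact ⟨Walk.nil, rfl, rfl⟩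
  | succ N ih =>
    intro h
    obtain ⟨w, hl, hs⟩ := ih fun i hi => h i (by omega)
    refine ⟨w.concat (h N (by omega)), by simp [hl], ?_⟩
    rw [Walk.support_concat, hs, List.range_succ (n := N + 1)]
    simp

theorem exists_isPath_of_forall_adj {G : SimpleGraph V} (p : ℕ → V) (N : ℕ)
    (h : ∀ i < N, G.Adj (p i) (p (i + 1))) (hinj : Set.InjOn p (Set.Iic N)) :
    ∃ w : G.Walk (p 0) (p N), w.length = N ∧ w.IsPath := by
  obtain ⟨w, hl, hs⟩ := exists_walk_of_forall_adj p N h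
  refine ⟨w, hl, ?_⟩
  rw [Walk.isPath_def, hs]
  refine List.Nodup.map_on ?_ List.nodup_range
  intro x hx y hy hxy
  exact hinj (by simpa [Nat.lt_succ_iff] using hx) (by simpa [Nat.lt_succ_iff] using hy) hxy

theorem Walk.color_eq {G : SimpleGraph V} {col : V → Bool}
    (hcol : ∀ a b, G.Adj a b → col b = !col a) {u v : V} (p : G.Walk u v) :
    col v = (col u ^^ p.length.bodd) := by
  induction p with
  | nil => simp
  | cons h p ih => rw [ih, hcol _ _ h, Walk.length_cons, Nat.bodd_succ]; simp

end SimpleGraph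

/-! ### Adding a path: the free construction step -/

namespace SimpleGraph

variable {U V W : Type*}

/-- The graph `G` together with the edges of the path `p 0, …, p (n - 2)`, prolonged to `p (n - 1)`
if `c` holds. -/
def addPath (G : SimpleGraph U) (n : ℕ) (p : ℕ → U) (c : Prop) : SimpleGraph U :=
  G ⊔ fromRel fun a b => ∃ i, i + 1 < n ∧ (c ∨ i + 2 < n) ∧ a = p i ∧ b = p (i + 1)

/-- The conditions under which adding a path is a free construction step: the inner vertices are
isolated, the path has no repetitions, and its ends are far apart if it is closed. -/
structure IsFreeStep (G : SimpleGraph U) (n : ℕ) (p : ℕ → U) (c : Prop) : Prop where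
  isolated : ∀ i, 0 < i → i + 1 < n → ∀ z, ¬ G.Adj (p i) z
  inj : ∀ i j, i + 1 < n → j + 1 < n → p i = p j → i = j
  ne_last : c → ∀ i, i + 1 < n → p i ≠ p (n - 1)
  far : c → ∀ w : G.Walk (p 0) (p (n - 1)), n < w.length

section addPath

variable {G : SimpleGraph U} {n : ℕ} {p : ℕ → U} {c : Prop}

theorem addPath_adj {a b : U} (h : (G.addPath n p c).Adj a b) :
    G.Adj a b ∨ ∃ i, i + 1 < n ∧ (c ∨ i + 2 < n) ∧
      (a = p i ∧ b = p (i + 1) ∨ b = p i ∧ a = p (i + 1)) := by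
  rcases h with h | ⟨-, ⟨i, hi, hc, h⟩ | ⟨i, hi, hc, h⟩⟩
  · exact Or.inl h
  · exact Or.inr ⟨i, hi, hc, Or.inl h⟩
  · exact Or.inr ⟨i, hi, hc, Or.inr h⟩

theorem le_addPath : G ≤ G.addPath n p c := le_sup_left

theorem IsFreeStep.path_adj (h : G.IsFreeStep n p c) {i : ℕ} (hi : i + 1 < n)
    (hc : c ∨ i + 2 < n) : (G.addPath n p c).Adj (p i) (p (i + 1)) := by
  refine Or.inr ⟨?_, Or.inl ⟨i, hi, hc, rfl, rfl⟩⟩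
  intro he
  by_cases hi2 : i + 2 < n
  · have := h.inj i (i + 1) hi hi2 he
    omega
  · have hc' : c := hc.resolve_right hi2
    refine h.ne_last hc' i hi ?_
    rwa [show n - 1 = i + 1 by omega]

theorem IsFreeStep.adj_inner (h : G.IsFreeStep n p c) {i : ℕ} (h0 : 0 < i) (hi : i + 1 < n) {z : U}
    (hz : (G.addPath n p c).Adj (p i) z) :
    z = p (i - 1) ∨ z = p (i + 1) ∧ (c ∨ i + 2 < n) := by
  rcases addPath_adj hz with hz | ⟨j, hj, hc, ⟨h1, h2⟩ | ⟨h1, h2⟩⟩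
  · exact absurd hz (h.isolated i h0 hi z)
  · obtain rfl := h.inj i j hi hj h1
    exact Or.inr ⟨h2, hc⟩
  · left
    by_cases hj2 : j + 2 < n
    · obtain rfl := h.inj i (j + 1) hi hj2 h2
      exact h1
    · refine absurd ?_ (h.ne_last (hc.resolve_right hj2) i hi)
      rwa [show n - 1 = j + 1 by omega]

theorem adj_of_addPath_adj (h3 : 3 ≤ n) {a b : U}
    (ha : ∀ i, 0 < i → i + 1 < n → a ≠ p i) (hb : ∀ i, 0 < i → i + 1 < n → b ≠ p i)
    (hab : (G.addPath n p c).Adj a b) : G.Adj a b := by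
  rcases addPath_adj hab with hz | ⟨j, hj, -, ⟨h1, h2⟩ | ⟨h1, h2⟩⟩
  · exact hz
  · rcases Nat.eq_zero_or_pos j with rfl | h0
    · exact absurd h2 (hb 1 (by omega) (by omega))
    · exact absurd h1 (ha j h0 hj)
  · rcases Nat.eq_zero_or_pos j with rfl | h0
    · exact absurd h2 (ha 1 (by omega) (by omega))
    · exact absurd h1 (hb j h0 hj)

theorem addPath_adj_outer {a b : U}
    (ha : ∀ i, 0 < i → i < n → a ≠ p i) (hab : (G.addPath n p c).Adj a b) :
    G.Adj a b ∨ a = p 0 ∧ b = p 1 := by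
  rcases addPath_adj hab with hz | ⟨j, hj, -, ⟨h1, h2⟩ | ⟨h1, h2⟩⟩
  · exact Or.inl hz
  · rcases Nat.eq_zero_or_pos j with rfl | h0
    · exact Or.inr ⟨h1, h2⟩
    · exact absurd h1 (ha j h0 (by omega))
  · exact absurd h2 (ha (j + 1) (by omega) (by omega))

/-- An inner vertex has no neighbours off the path, so two neighbours in `s` put both path
neighbours into `s`, and membership spreads along the path. At `p (n - 2)` a second neighbour exists
only if the path is closed. -/
theorem IsFreeStep.closed_of_two_neighbors (h : G.IsFreeStep n p c) {s : Set U}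
    (hs : ∀ i, 0 < i → i + 1 < n → p i ∈ s →
      ∃ a ∈ s, ∃ b ∈ s, a ≠ b ∧ (G.addPath n p c).Adj (p i) a ∧ (G.addPath n p c).Adj (p i) b)
    {i : ℕ} (h0 : 0 < i) (hi : i + 1 < n) (his : p i ∈ s) : c ∧ ∀ j < n, p j ∈ s := by
  have key : ∀ i, 0 < i → i + 1 < n → p i ∈ s →
      (p (i - 1) ∈ s ∧ p (i + 1) ∈ s) ∧ (c ∨ i + 2 < n) := by
    intro i h0 hi his
    have hcc : c ∨ i + 2 < n := by
      obtain ⟨a, -, b, -, hab, ha, hb⟩ := hs i h0 hi his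
      rcases h.adj_inner h0 hi ha with h1 | ⟨-, h1⟩
      · rcases h.adj_inner h0 hi hb with h2 | ⟨-, h2⟩
        · exact absurd (h1.trans h2.symm) hab
        · exact h2
      · exact h1
    exact ⟨mem_and_mem_of_two_neighbors (hs i h0 hi his)
      fun z hz => (h.adj_inner h0 hi hz).imp id And.left, hcc⟩
  have hall := forall_mem_of_forall_interior (s := s) (p := p) (N := n - 1)
    (fun i h0 hi his => (key i h0 (by omega) his).1) h0 (by omega) his
  refine ⟨?_, fun j hj => hall j (by omega)⟩
  rcases (key (n - 2) (by omega) (by omega) (hall (n - 2) (by omega))).2 with h | h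
  · exact h
  · omega

/-- A core meeting the interior of the path contains all of the path. Without the n - 2 inner
vertices it either contains an old core or joins the two ends by a walk; that walk has length at
least n + 1, so at least n + 2 vertices remain. -/
theorem IsFreeStep.coreBound (h : G.IsFreeStep n p c) (h3 : 3 ≤ n) (hG : G.CoreBound (2 * n)) :
    (G.addPath n p c).CoreBound (2 * n) := by
  classical
  intro s hne hs
  by_cases hin : ∃ i, 0 < i ∧ i + 1 < n ∧ p i ∈ s
  · obtain ⟨i, h0, hi, his⟩ := hin
    obtain ⟨hc, hall⟩ := h.closed_of_two_neighbors (s := (s : Set U))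
      (fun i _ _ his => hs _ his) h0 hi his
    let F : Finset U := (Finset.Ico 1 (n - 1)).image p
    have hF : ∀ z, z ∈ F ↔ ∃ i, 0 < i ∧ i + 1 < n ∧ p i = z := by
      intro z
      simp only [F, Finset.mem_image, Finset.mem_Ico]
      exact ⟨fun ⟨i, hi, h⟩ => ⟨i, by omega, by omega, h⟩,
        fun ⟨i, h1, h2, h⟩ => ⟨i, by omega, h⟩⟩
    have hFs : F ⊆ s := by
      intro z hz
      obtain ⟨i, -, hi, rfl⟩ := (hF z).1 hz
      exact hall i (by omega)
    have hFc : F.card = n - 2 := by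
      rw [Finset.card_image_of_injOn]
      · simp; omega
      · intro i hi j hj hij
        simp only [Finset.coe_Ico, Set.mem_Ico] at hi hj
        exact h.inj i j (by omega) (by omega) hij
    have hcard := Finset.card_sdiff_add_card_eq_card hFs
    have hnF : ∀ y z, G.Adj y z → z ∉ F := by
      intro y z hyz hz
      obtain ⟨i, h0, hi, rfl⟩ := (hF z).1 hz
      exact h.isolated i h0 hi y hyz.symm
    have hu : p 0 ∈ s \ F := by
      refine Finset.mem_sdiff.2 ⟨hall 0 (by omega), fun h' => ?_⟩
      obtain ⟨i, h0, hi, he⟩ := (hF _).1 h'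
      have := h.inj i 0 hi (by omega) he
      omega
    have hv : p (n - 1) ∈ s \ F := by
      refine Finset.mem_sdiff.2 ⟨hall _ (by omega), fun h' => ?_⟩
      obtain ⟨i, h0, hi, he⟩ := (hF _).1 h'
      exact h.ne_last hc i hi he
    have houter : ∀ y ∈ s \ F, y ≠ p (n - 1) → ∀ i, 0 < i → i < n → y ≠ p i := by
      intro y hy hyv i h0 hi he
      by_cases hi' : i + 1 < n
      · exact (Finset.mem_sdiff.1 hy).2 ((hF y).2 ⟨i, h0, hi', he.symm⟩)
      · exact hyv (by rw [he]; congr 1; omega)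
    have hu1 : ∃ a ∈ s \ F, G.Adj (p 0) a := by
      obtain ⟨a, ha, b, hb, hab, hua, hub⟩ := hs _ (hall 0 (by omega))
      have h1 := houter _ hu (h.ne_last hc 0 (by omega))
      rcases addPath_adj_outer h1 hua with hua | ⟨-, rfl⟩
      · exact ⟨a, Finset.mem_sdiff.2 ⟨ha, hnF _ _ hua⟩, hua⟩
      · rcases addPath_adj_outer h1 hub with hub | ⟨-, rfl⟩
        · exact ⟨b, Finset.mem_sdiff.2 ⟨hb, hnF _ _ hub⟩, hub⟩
        · exact absurd rfl hab
    rcases exists_core_or_walk G (s \ F) hu hv hu1 (by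
      intro y hy hyu hyv
      obtain ⟨a, ha, b, hb, hab, hya, hyb⟩ := hs y (Finset.mem_sdiff.1 hy).1
      have h1 := houter y hy hyv
      have hya := (addPath_adj_outer h1 hya).resolve_right fun h' => hyu h'.1
      have hyb := (addPath_adj_outer h1 hyb).resolve_right fun h' => hyu h'.1
      exact ⟨a, Finset.mem_sdiff.2 ⟨ha, hnF _ _ hya⟩, b, Finset.mem_sdiff.2 ⟨hb, hnF _ _ hyb⟩,
        hab, hya, hyb⟩) with ⟨t, ht, htne, htc⟩ | ⟨w, hw⟩
    · have := hG t htne htc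
      have := Finset.card_le_card ht
      omega
    · have := h.far hc w
      omega
  · push Not at hin
    refine hG s hne fun y hy => ?_
    obtain ⟨a, ha, b, hb, hab, hya, hyb⟩ := hs y hy
    have hn : ∀ z ∈ s, ∀ i, 0 < i → i + 1 < n → z ≠ p i := by
      rintro z hz i h0 hi rfl
      exact hin i h0 hi hz
    exact ⟨a, ha, b, hb, hab, adj_of_addPath_adj h3 (hn y hy) (hn a ha) hya,
      adj_of_addPath_adj h3 (hn y hy) (hn b hb) hyb⟩

end addPath

/-! ### The free completion -/

/-- The vertex set of a free completion. -/
abbrev Completion (V : Type*) := V ⊕ (ℕ × ℕ × Bool)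

namespace Completion

variable (G : SimpleGraph V) (col : V → Bool) (n : ℕ) (task : ℕ → Completion V × Completion V)

/-- The stage after which a vertex is available. -/
def level : Completion V → ℕ := Sum.elim (fun _ => 0) fun z => z.1 + 1

/-- The colouring of the free completion. -/
def color : Completion V → Bool := Sum.elim col fun z => z.2.2

/-- The path added at stage `t`. -/
def path (t i : ℕ) : Completion V :=
  if i = 0 then (task t).1
  else if i + 1 < n then Sum.inr (t, i, color col (task t).1 ^^ i.bodd) else (task t).2

/-- The path added to `H` at stage `t` is closed. -/
def IsClosing (t : ℕ) (H : SimpleGraph (Completion V)) : Prop :=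
  level (task t).2 ≤ t ∧ color col (task t).2 = (color col (task t).1 ^^ (n - 1).bodd) ∧
    ∀ w : H.Walk (task t).1 (task t).2, n < w.length

open Classical in
/-- The stages of the free completion. -/
noncomputable def stage : ℕ → SimpleGraph (Completion V)
  | 0 => G.map (Function.Embedding.inl : V ↪ Completion V)
  | t + 1 => if level (task t).1 ≤ t then
      (stage t).addPath n (path col n task t) (IsClosing col n task t (stage t))
    else stage t

variable {G col n task}

theorem stage_zero_adj {a b : Completion V} :
    (stage G col n task 0).Adj a b ↔ ∃ x y, G.Adj x y ∧ Sum.inl x = a ∧ Sum.inl y = b :=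
  map_adj (Function.Embedding.inl : V ↪ Completion V) G a b

theorem path_zero (t : ℕ) : path col n task t 0 = (task t).1 := rfl

theorem path_inner {t i : ℕ} (h0 : 0 < i) (hi : i + 1 < n) :
    path col n task t i = Sum.inr (t, i, color col (task t).1 ^^ i.bodd) := by
  simp [path, h0.ne', hi]

theorem path_last (h3 : 3 ≤ n) (t : ℕ) : path col n task t (n - 1) = (task t).2 := by
  have h1 : n - 1 ≠ 0 := by omega
  have h2 : ¬ (n - 1 + 1 < n) := by omega
  simp [path, h1, h2]

theorem level_path_inner {t i : ℕ} (h0 : 0 < i) (hi : i + 1 < n) :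
    level (path col n task t i) = t + 1 := by
  rw [path_inner h0 hi]; rfl

theorem stage_succ_of_le {t : ℕ} (h : level (task t).1 ≤ t) :
    stage G col n task (t + 1) = (stage G col n task t).addPath n (path col n task t)
      (IsClosing col n task t (stage G col n task t)) := by
  rw [stage, if_pos h]

theorem stage_succ_of_not_le {t : ℕ} (h : ¬ level (task t).1 ≤ t) :
    stage G col n task (t + 1) = stage G col n task t := by
  rw [stage, if_neg h]

theorem level_le (h3 : 3 ≤ n) : ∀ (t : ℕ) {a b : Completion V}, (stage G col n task t).Adj a b →
    level a ≤ t := by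
  intro t
  induction t with
  | zero =>
    intro a b h
    obtain ⟨x, y, -, rfl, rfl⟩ := stage_zero_adj.1 h
    exact le_rfl
  | succ t ih =>
    intro a b h
    by_cases hl : level (task t).1 ≤ t
    · rw [stage_succ_of_le hl] at h
      have hp : ∀ i, i + 1 < n → level (path col n task t i) ≤ t + 1 := by
        intro i hi
        rcases Nat.eq_zero_or_pos i with rfl | h0
        · rw [path_zero]; omega
        · exact (level_path_inner h0 hi).le
      rcases addPath_adj h with h | ⟨i, hi, hc, ⟨rfl, -⟩ | ⟨-, rfl⟩⟩
      · exact (ih h).trans (by omega)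
      · exact hp i hi
      · by_cases hi2 : i + 2 < n
        · exact hp _ hi2
        · rw [show i + 1 = n - 1 by omega, path_last h3]
          exact (hc.resolve_right hi2).1.trans (by omega)
    · rw [stage_succ_of_not_le hl] at h
      exact (ih h).trans (by omega)

/-- Edges of stage `t` join vertices of level at most `t`, while the inner vertices of the new path
have level `t + 1`, so they are isolated. Coinciding ends are excluded in the closed case by the
walk of length 0. -/
theorem isFreeStep (h3 : 3 ≤ n) {t : ℕ} (hl : level (task t).1 ≤ t) :
    (stage G col n task t).IsFreeStep n (path col n task t)
      (IsClosing col n task t (stage G col n task t)) where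
  isolated i h0 hi z hz := by
    have := level_le h3 t hz
    rw [level_path_inner h0 hi] at this
    omega
  inj i j hi hj h := by
    rcases Nat.eq_zero_or_pos i with rfl | hi0 <;> rcases Nat.eq_zero_or_pos j with rfl | hj0
    · rfl
    · have := congrArg level h
      rw [level_path_inner hj0 hj, path_zero] at this
      omega
    · have := congrArg level h
      rw [level_path_inner hi0 hi, path_zero] at this
      omega
    · rw [path_inner hi0 hi, path_inner hj0 hj] at h
      simp only [Sum.inr.injEq, Prod.mk.injEq] at h
      exact h.2.1
  ne_last hc i hi h := by
    rw [path_last h3] at h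
    rcases Nat.eq_zero_or_pos i with rfl | hi0
    · rw [path_zero] at h
      have := hc.2.2 (Walk.nil.copy rfl h)
      simp at this
    · have := congrArg level h
      rw [level_path_inner hi0 hi] at this
      have := hc.1
      omega
  far hc w := by
    have := hc.2.2 (w.copy (path_zero t) (path_last h3 t))
    simpa using this

theorem color_adj (h3 : 3 ≤ n) (hcol : ∀ a b, G.Adj a b → col b = !col a) :
    ∀ (t : ℕ) {a b : Completion V}, (stage G col n task t).Adj a b →
      color col b = !color col a := by
  intro t
  induction t with
  | zero =>
    intro a b h
    obtain ⟨x, y, hxy, rfl, rfl⟩ := stage_zero_adj.1 h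
    exact hcol x y hxy
  | succ t ih =>
    intro a b h
    by_cases hl : level (task t).1 ≤ t
    · rw [stage_succ_of_le hl] at h
      have hp : ∀ i, i + 1 < n → color col (path col n task t i) =
          (color col (task t).1 ^^ i.bodd) := by
        intro i hi
        rcases Nat.eq_zero_or_pos i with rfl | h0
        · simp [path_zero]
        · rw [path_inner h0 hi]; rfl
      have hpp : ∀ i, i + 1 < n → (IsClosing col n task t (stage G col n task t) ∨ i + 2 < n) →
          color col (path col n task t (i + 1)) = !color col (path col n task t i) := by
        intro i hi hc
        have : color col (path col n task t (i + 1)) =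
            (color col (task t).1 ^^ (i + 1).bodd) := by
          by_cases hi2 : i + 2 < n
          · exact hp _ hi2
          · have hin : i + 1 = n - 1 := by omega
            rw [hin, path_last h3]
            exact (hc.resolve_right hi2).2.1
        rw [this, hp i hi, Nat.bodd_succ]
        simp
      rcases addPath_adj h with h | ⟨i, hi, hc, ⟨rfl, rfl⟩ | ⟨rfl, rfl⟩⟩
      · exact ih h
      · exact hpp i hi hc
      · rw [hpp i hi hc, Bool.not_not]
    · rw [stage_succ_of_not_le hl] at h
      exact ih h

theorem coreBound_stage (h3 : 3 ≤ n) (hG : G.CoreBound (2 * n)) :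
    ∀ t, (stage G col n task t).CoreBound (2 * n) := by
  intro t
  induction t with
  | zero =>
    intro s hne hs
    have hmem : ∀ y ∈ s, ∃ x, Sum.inl x = y := by
      intro y hy
      obtain ⟨a, -, -, -, -, h, -⟩ := hs y hy
      obtain ⟨x, -, -, h, -⟩ := stage_zero_adj.1 h
      exact ⟨x, h⟩
    have hadj : ∀ x z : V, (stage G col n task 0).Adj (Sum.inl x) (Sum.inl z) → G.Adj x z := by
      intro x z h
      obtain ⟨x', z', h, hx, hz⟩ := stage_zero_adj.1 h
      rwa [← Sum.inl_injective hx, ← Sum.inl_injective hz]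
    refine (hG s.toLeft ?_ ?_).trans (Finset.card_toLeft_le)
    · obtain ⟨y, hy⟩ := hne
      obtain ⟨x, rfl⟩ := hmem y hy
      exact ⟨x, Finset.mem_toLeft.2 hy⟩
    · intro y hy
      obtain ⟨a, ha, b, hb, hab, hya, hyb⟩ := hs _ (Finset.mem_toLeft.1 hy)
      obtain ⟨a, rfl⟩ := hmem a ha
      obtain ⟨b, rfl⟩ := hmem b hb
      exact ⟨a, Finset.mem_toLeft.2 ha, b, Finset.mem_toLeft.2 hb,
        fun h => hab (congrArg _ h), hadj _ _ hya, hadj _ _ hyb⟩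
  | succ t ih =>
    by_cases hl : level (task t).1 ≤ t
    · rw [stage_succ_of_le hl]
      exact (isFreeStep h3 hl).coreBound h3 ih
    · rwa [stage_succ_of_not_le hl]

theorem stage_mono : Monotone (stage G col n task) := by
  refine monotone_nat_of_le_succ fun t => ?_
  by_cases hl : level (task t).1 ≤ t
  · rw [stage_succ_of_le hl]
    exact le_addPath
  · rw [stage_succ_of_not_le hl]

/-- As `3 ≤ n`, every edge of a later path has an inner vertex as an end, and the level of that
vertex exceeds `t`. -/
theorem stage_adj_of_level_le (h3 : 3 ≤ n) {t : ℕ} {a b : Completion V} (ha : level a ≤ t)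
    (hb : level b ≤ t) : ∀ d, (stage G col n task (t + d)).Adj a b →
      (stage G col n task t).Adj a b := by
  intro d
  induction d with
  | zero => exact id
  | succ d ih =>
    intro h
    apply ih
    rw [← add_assoc] at h
    by_cases hl : level (task (t + d)).1 ≤ t + d
    · rw [stage_succ_of_le hl] at h
      refine adj_of_addPath_adj h3 ?_ ?_ h <;>
      · intro i h0 hi he
        have := congrArg level he
        rw [level_path_inner h0 hi] at this
        omega
    · rwa [stage_succ_of_not_le hl] at h

variable (G col n task) in
/-- The union of the stages. -/
noncomputable def limit : SimpleGraph (Completion V) := ⨆ t, stage G col n task t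

theorem stage_le_limit (t : ℕ) : stage G col n task t ≤ limit G col n task := le_iSup _ t

theorem limit_adj {a b : Completion V} :
    (limit G col n task).Adj a b ↔ ∃ t, (stage G col n task t).Adj a b := by
  simp [limit]

theorem stage_adj_of_limit_adj (h3 : 3 ≤ n) {t : ℕ} {a b : Completion V} (ha : level a ≤ t)
    (hb : level b ≤ t) (h : (limit G col n task).Adj a b) : (stage G col n task t).Adj a b := by
  obtain ⟨t', h⟩ := limit_adj.1 h
  refine stage_adj_of_level_le h3 ha hb t' (stage_mono ?_ h)
  omega

theorem coreBound_limit (h3 : 3 ≤ n) (hG : G.CoreBound (2 * n)) :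
    (limit G col n task).CoreBound (2 * n) := by
  intro s hne hs
  let T := s.sup level
  refine coreBound_stage (task := task) (col := col) h3 hG T s hne fun y hy => ?_
  obtain ⟨a, ha, b, hb, hab, hya, hyb⟩ := hs y hy
  have hT : ∀ z ∈ s, level z ≤ T := fun z hz => Finset.le_sup hz
  exact ⟨a, ha, b, hb, hab, stage_adj_of_limit_adj h3 (hT y hy) (hT a ha) hya,
    stage_adj_of_limit_adj h3 (hT y hy) (hT b hb) hyb⟩

/-- Take a vertex of maximal level `t + 1`. All edges in the finite set then belong to stage `t +
1`, where this vertex has at most the edges of the path added last. Without a loose end, the whole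
closed path lies in the set and gives a clean arc. -/
theorem hyperfreeOver_limit (h3 : 3 ≤ n) :
    (limit G col n task).HyperfreeOver n (Set.range Sum.inl) Set.univ := by
  intro s hs _ hne
  obtain ⟨y, hy, hmax⟩ := Set.exists_max_image s level hs (hne.mono Set.sdiff_subset)
  obtain ⟨t, i, b, rfl⟩ : ∃ t i b, y = Sum.inr (t, i, b) := by
    obtain ⟨z, hz, hzr⟩ := hne
    rcases z with z | ⟨t, i, b⟩
    · exact absurd ⟨z, rfl⟩ hzr
    · rcases y with y | ⟨t', i', b'⟩
      · have := hmax _ hz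
        simp [level] at this
      · exact ⟨_, _, _, rfl⟩
  have hmax : ∀ z ∈ s, level z ≤ t + 1 := hmax
  have hadj : ∀ a ∈ s, ∀ b ∈ s, (limit G col n task).Adj a b →
      (stage G col n task (t + 1)).Adj a b := fun a ha b hb h =>
    stage_adj_of_limit_adj h3 (hmax a ha) (hmax b hb) h
  by_contra hcon
  push Not at hcon
  obtain ⟨hloose, harc⟩ := hcon
  have htwo : ∀ y ∈ s, y ∉ Set.range Sum.inl → ∃ a ∈ s, ∃ b ∈ s, a ≠ b ∧
      (stage G col n task (t + 1)).Adj y a ∧ (stage G col n task (t + 1)).Adj y b := by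
    intro y hy hyr
    obtain ⟨a, ha, b, hb, hya, hyb, hab⟩ := hloose y ⟨hy, hyr⟩
    exact ⟨a, ha, b, hb, hab, hadj y hy a ha hya, hadj y hy b hb hyb⟩
  obtain ⟨a, ha, -, -, -, hya, -⟩ := htwo _ hy (by simp)
  by_cases hl : level (task t).1 ≤ t
  swap
  · rw [stage_succ_of_not_le hl] at hya
    have := level_le h3 t hya
    simp [level] at this
  have hfree := isFreeStep (G := G) (col := col) h3 hl
  rw [stage_succ_of_le hl] at htwo hya
  obtain ⟨j, hj0, hj, hjy⟩ : ∃ j, 0 < j ∧ j + 1 < n ∧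
      path col n task t j = Sum.inr (t, i, b) := by
    rcases addPath_adj hya with h | ⟨j, hj, hc, ⟨h, -⟩ | ⟨-, h⟩⟩
    · have := level_le h3 t h
      simp [level] at this
    · rcases Nat.eq_zero_or_pos j with rfl | h0
      · rw [path_zero] at h
        rw [← h] at hl
        simp [level] at hl
      · exact ⟨j, h0, hj, h.symm⟩
    · by_cases hj2 : j + 2 < n
      · exact ⟨j + 1, by omega, hj2, h.symm⟩
      · rw [show j + 1 = n - 1 by omega, path_last h3] at h
        have := (hc.resolve_right hj2).1
        rw [← h] at this
        simp [level] at this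
  have hnr : ∀ i, 0 < i → i + 1 < n → path col n task t i ∉ Set.range Sum.inl := by
    intro i h0 hi
    rw [path_inner h0 hi]
    simp
  obtain ⟨hc, hall⟩ := hfree.closed_of_two_neighbors (s := s)
    (fun i h0 hi his => htwo _ his (hnr i h0 hi)) hj0 hj (by rw [hjy]; exact hy)
  have hpadj : ∀ i, i + 1 < n → (limit G col n task).Adj (path col n task t i)
      (path col n task t (i + 1)) := by
    intro i hi
    have := hfree.path_adj hi (Or.inl hc)
    rw [← stage_succ_of_le hl] at this
    exact stage_le_limit _ this
  obtain ⟨i, h0, hi, h⟩ := harc (path col n task t) (by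
    intro i hi j hj hij
    simp only [Set.mem_Iio] at hi hj
    by_cases hi' : i + 1 < n <;> by_cases hj' : j + 1 < n
    · exact hfree.inj i j hi' hj' hij
    · refine absurd ?_ (hfree.ne_last hc i hi')
      rwa [show n - 1 = j by omega]
    · refine absurd ?_ (hfree.ne_last hc j hj')
      rw [show n - 1 = i by omega]
      exact hij.symm
    · omega) hall hpadj
  obtain ⟨z, hz, hpz, h1, h2⟩ := h (hnr i h0 hi)
  have hpz := hadj _ (hall i (by omega)) z hz hpz
  rw [stage_succ_of_le hl] at hpz
  rcases hfree.adj_inner h0 hi hpz with h | ⟨h, -⟩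
  · exact h1 h
  · exact h2 h

/-- The task `(u, u)` recurs infinitely often after `u` is available, and each time a path with a
fresh first inner vertex starts at `u`. -/
theorem infinite_neighborSet_limit (h3 : 3 ≤ n)
    (htask : ∀ x N, ∃ t, N ≤ t ∧ task t = x) (u : Completion V) :
    ((limit G col n task).neighborSet u).Infinite := by
  have hinf : {t | level u ≤ t ∧ task t = (u, u)}.Infinite := by
    rw [Set.infinite_iff_exists_gt]
    intro N
    obtain ⟨t, ht, htu⟩ := htask (u, u) (N + 1 + level u)
    exact ⟨t, ⟨by omega, htu⟩, by omega⟩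
  refine Set.infinite_of_injOn_mapsTo (f := fun t => path col n task t 1) ?_ ?_ hinf
  · intro t _ t' _ h
    simp only [path_inner (col := col) (task := task) one_pos (show 1 + 1 < n by omega)] at h
    simp only [Sum.inr.injEq, Prod.mk.injEq] at h
    exact h.1
  · rintro t ⟨ht, htu⟩
    have hl : level (task t).1 ≤ t := by rw [htu]; exact ht
    have := (isFreeStep (G := G) (col := col) h3 hl).path_adj (i := 0) (by omega)
      (Or.inr (by omega))
    rw [← stage_succ_of_le hl, path_zero, htu] at this
    exact stage_le_limit _ this

/-- If the colours fit a path of length n - 1, the task `(u, v)` adds one unless a walk of length at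
most n exists already. Otherwise pass to a neighbour `v'` of `v`: the walk to `v'` has the parity of
n - 1, hence length at most n - 1, which leaves room for one more edge. -/
theorem exists_walk_limit (h3 : 3 ≤ n) (hcol : ∀ a b, G.Adj a b → col b = !col a)
    (htask : ∀ x N, ∃ t, N ≤ t ∧ task t = x) (u v : Completion V) :
    ∃ w : (limit G col n task).Walk u v, w.length ≤ n := by
  have hcol' : ∀ a b, (limit G col n task).Adj a b → color col b = !color col a := by
    intro a b h
    obtain ⟨t, h⟩ := limit_adj.1 h
    exact color_adj h3 hcol t h
  have key : ∀ v, color col v = (color col u ^^ (n - 1).bodd) →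
      ∃ w : (limit G col n task).Walk u v, w.length ≤ n := by
    intro v hv
    obtain ⟨t, ht, htask⟩ := htask (u, v) (level u + level v)
    by_cases hw : ∃ w : (stage G col n task t).Walk u v, w.length ≤ n
    · obtain ⟨w, hw⟩ := hw
      exact ⟨w.mapLe (stage_le_limit t), by simpa using hw⟩
    · push Not at hw
      have hl : level (task t).1 ≤ t := by rw [htask]; simp only; omega
      have hc : IsClosing col n task t (stage G col n task t) := by
        unfold IsClosing
        rw [htask]
        exact ⟨by simp only; omega, hv, hw⟩
      have hfree := isFreeStep (G := G) (col := col) h3 hl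
      obtain ⟨w, hw, -⟩ := exists_walk_of_forall_adj (path col n task t) (n - 1)
        (fun i hi => stage_le_limit (t + 1) (by
          rw [stage_succ_of_le hl]
          exact hfree.path_adj (by omega) (Or.inl hc)))
      refine ⟨w.copy ((path_zero t).trans (by rw [htask])) ((path_last h3 t).trans (by rw [htask])), ?_⟩
      rw [Walk.length_copy]
      omega
  by_cases hv : color col v = (color col u ^^ (n - 1).bodd)
  · exact key v hv
  · obtain ⟨v', hv'⟩ := (infinite_neighborSet_limit (G := G) (col := col) h3 htask v).nonempty
    have hv' : (limit G col n task).Adj v v' := hv'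
    have hcv := hcol' _ _ hv'
    obtain ⟨w, hw⟩ := key v' (by
      revert hv hcv
      cases color col v <;> cases color col v' <;> cases color col u <;> cases (n - 1).bodd <;>
        simp)
    have hwc := w.color_eq hcol'
    have hlt : w.length ≠ n := by
      intro h
      rw [h, show n = (n - 1) + 1 by omega, Nat.bodd_succ, hcv] at hwc
      revert hv hwc
      cases color col v <;> cases color col u <;> cases (n - 1).bodd <;> simp
    exact ⟨w.concat hv'.symm, by rw [Walk.length_concat]; omega⟩

end Completion

theorem exists_completion {V : Type} [Countable V] {n : ℕ} (h3 : 3 ≤ n) (G : SimpleGraph V)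
    (col : V → Bool) (hcol : ∀ a b, G.Adj a b → col b = !col a) (hG : G.CoreBound (2 * n)) :
    ∃ (H : SimpleGraph (Completion V)) (col' : Completion V → Bool),
      (∀ a b, H.Adj (Sum.inl a) (Sum.inl b) ↔ G.Adj a b) ∧ (∀ a, col' (Sum.inl a) = col a) ∧
      (∀ a b, H.Adj a b → col' b = !col' a) ∧ H.CoreBound (2 * n) ∧
      (∀ u v, ∃ w : H.Walk u v, w.length ≤ n) ∧ (∀ u, (H.neighborSet u).Infinite) ∧
      H.HyperfreeOver n (Set.range Sum.inl) Set.univ := by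
  -- The additional factor `ℕ` makes every task occur infinitely often.
  obtain ⟨g, hg⟩ := exists_surjective_nat ((Completion V × Completion V) × ℕ)
  let task : ℕ → Completion V × Completion V := fun t => (g t).1
  have htask : ∀ x N, ∃ t, N ≤ t ∧ task t = x := by
    intro x N
    have hinf : {t | task t = x}.Infinite := by
      refine Set.Infinite.of_image (fun t => (g t).2) ?_
      convert Set.infinite_univ (α := ℕ)
      refine Set.eq_univ_of_forall fun k => ?_
      obtain ⟨t, ht⟩ := hg (x, k)
      exact ⟨t, by simp [task, ht], by simp [ht]⟩
    obtain ⟨t, ht, h⟩ := hinf.exists_gt N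
    exact ⟨t, h.le, ht⟩
  refine ⟨Completion.limit G col n task, Completion.color col, ?_, fun _ => rfl, ?_,
    Completion.coreBound_limit h3 hG, Completion.exists_walk_limit h3 hcol htask,
    Completion.infinite_neighborSet_limit h3 htask, Completion.hyperfreeOver_limit h3⟩
  · intro a b
    constructor
    · intro h
      obtain ⟨x, y, h, hx, hy⟩ := Completion.stage_zero_adj.1
        (Completion.stage_adj_of_limit_adj h3 (t := 0) le_rfl le_rfl h)
      rwa [← Sum.inl_injective hx, ← Sum.inl_injective hy]
    · intro h
      exact Completion.stage_le_limit 0 (Completion.stage_zero_adj.2 ⟨a, b, h, rfl, rfl⟩)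
  · intro a b h
    obtain ⟨t, h⟩ := Completion.limit_adj.1 h
    exact Completion.color_adj h3 hcol t h

end SimpleGraph

/-! ### Closed hexagons with subdivided sides -/

namespace SimpleGraph

/-- The `k`-th vertex of the `i`-th side of a closed hexagon with sides of length `m`. -/
def hexVertex (m : ℕ) (i : ZMod 6) (k : ℕ) : ZMod 6 × ℕ := if k < m then (i, k) else (i + 1, 0)

/-- A closed hexagon with sides of length `m`, together with isolated vertices. -/
def hexagon (m : ℕ) : SimpleGraph (ZMod 6 × ℕ) :=
  fromRel fun a b => ∃ i, ∃ k < m, a = hexVertex m i k ∧ b = hexVertex m i (k + 1)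

/-- A proper colouring of the hexagon. -/
def hexColor (m : ℕ) (a : ZMod 6 × ℕ) : Bool := (a.1.val.bodd && m.bodd) ^^ a.2.bodd

/-- Two consecutive sides of the hexagon. -/
def hexPath (m j : ℕ) : ZMod 6 × ℕ := if j ≤ m then hexVertex m 0 j else hexVertex m 1 (j - m)

section hexagon

variable {m : ℕ}

theorem hexVertex_of_lt {i : ZMod 6} {k : ℕ} (h : k < m) : hexVertex m i k = (i, k) := if_pos h

theorem hexVertex_self (i : ZMod 6) : hexVertex m i m = (i + 1, 0) := if_neg (lt_irrefl m)

theorem hexVertex_eq_iff {i i' : ZMod 6} {k k' : ℕ} (hk : k < m) :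
    (i', k') = hexVertex m i (k + 1) ↔
      k + 1 < m ∧ i' = i ∧ k' = k + 1 ∨ k + 1 = m ∧ i' = i + 1 ∧ k' = 0 := by
  unfold hexVertex
  split_ifs with h
  · have : k + 1 ≠ m := by omega
    simp [h, this]
  · have : k + 1 = m := by omega
    simp [this]

theorem hexVertex_injOn (i : ZMod 6) : Set.InjOn (hexVertex m i) (Set.Iic m) := by
  have hi : i ≠ i + 1 := by revert i; decide
  intro k hk k' hk' h
  simp only [Set.mem_Iic] at hk hk'
  unfold hexVertex at h
  split_ifs at h with h1 h2 h2
  · exact (Prod.mk.inj h).2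
  · exact absurd (Prod.mk.inj h).1 hi
  · exact absurd (Prod.mk.inj h).1.symm hi
  · omega

theorem hexagon_adj {i : ZMod 6} {k : ℕ} (h : k < m) :
    (hexagon m).Adj (hexVertex m i k) (hexVertex m i (k + 1)) :=
  ⟨fun he => by
    have := hexVertex_injOn i (Set.mem_Iic.2 h.le) (Set.mem_Iic.2 h) he
    omega, Or.inl ⟨i, k, h, rfl, rfl⟩⟩

theorem exists_of_hexagon_adj {a b : ZMod 6 × ℕ} (h : (hexagon m).Adj a b) :
    ∃ i, ∃ k < m, a = (i, k) ∧ b = hexVertex m i (k + 1) ∨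
      b = (i, k) ∧ a = hexVertex m i (k + 1) := by
  rcases h with ⟨-, ⟨i, k, hk, ha, hb⟩ | ⟨i, k, hk, ha, hb⟩⟩
  · exact ⟨i, k, hk, Or.inl ⟨ha.trans (hexVertex_of_lt hk), hb⟩⟩
  · exact ⟨i, k, hk, Or.inr ⟨ha.trans (hexVertex_of_lt hk), hb⟩⟩

theorem lt_of_hexagon_adj {i : ZMod 6} {k : ℕ} {z : ZMod 6 × ℕ}
    (h : (hexagon m).Adj (i, k) z) : k < m := by
  obtain ⟨j, l, hl, ⟨h1, -⟩ | ⟨-, h1⟩⟩ := exists_of_hexagon_adj h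
  · exact (Prod.mk.inj h1).2 ▸ hl
  · rw [hexVertex_eq_iff hl] at h1
    omega

theorem hexagon_adj_inner {i : ZMod 6} {k : ℕ} (h0 : 0 < k) {z : ZMod 6 × ℕ}
    (h : (hexagon m).Adj (i, k) z) : z = hexVertex m i (k - 1) ∨ z = hexVertex m i (k + 1) := by
  have hk := lt_of_hexagon_adj h
  obtain ⟨j, l, hl, ⟨h1, rfl⟩ | ⟨rfl, h1⟩⟩ := exists_of_hexagon_adj h
  · obtain ⟨rfl, rfl⟩ := Prod.mk.inj h1
    exact Or.inr rfl
  · rcases (hexVertex_eq_iff hl).1 h1 with ⟨-, rfl, rfl⟩ | ⟨-, -, h⟩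
    · left; rw [Nat.add_sub_cancel, hexVertex_of_lt hl]
    · omega

theorem hexagon_adj_corner {i : ZMod 6} {z : ZMod 6 × ℕ}
    (h : (hexagon m).Adj (i, 0) z) : z = hexVertex m i 1 ∨ z = (i - 1, m - 1) := by
  obtain ⟨j, l, hl, ⟨h1, rfl⟩ | ⟨rfl, h1⟩⟩ := exists_of_hexagon_adj h
  · obtain ⟨rfl, rfl⟩ := Prod.mk.inj h1
    exact Or.inl rfl
  · rcases (hexVertex_eq_iff hl).1 h1 with ⟨-, -, h⟩ | ⟨hl', rfl, -⟩
    · omega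
    · right; rw [add_sub_cancel_right, ← hl', Nat.add_sub_cancel]

/-- The colours match around the cycle because six is even: the parity of `i.val` changes at every
corner, also from 5 to 0. -/
theorem hexColor_adj {a b : ZMod 6 × ℕ} (h : (hexagon m).Adj a b) :
    hexColor m b = !hexColor m a := by
  have key : ∀ i, ∀ k < m, hexColor m (hexVertex m i (k + 1)) = !hexColor m (i, k) := by
    intro i k hk
    unfold hexVertex
    split_ifs with h
    · simp only [hexColor, Nat.bodd_succ]
      simp
    · obtain rfl : m = k + 1 := by omega
      have : (i + 1).val.bodd = !i.val.bodd := by revert i; decide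
      simp only [hexColor, this, Nat.bodd_succ, Nat.bodd_zero]
      cases i.val.bodd <;> cases k.bodd <;> rfl
  obtain ⟨i, k, hk, ⟨rfl, rfl⟩ | ⟨rfl, rfl⟩⟩ := exists_of_hexagon_adj h
  · exact key i k hk
  · rw [key i k hk, Bool.not_not]

theorem hexVertex_mem_of_inner {s : Set (ZMod 6 × ℕ)} {i : ZMod 6}
    (hs : ∀ k, 0 < k → (i, k) ∈ s →
      ∃ a ∈ s, ∃ b ∈ s, a ≠ b ∧ (hexagon m).Adj (i, k) a ∧ (hexagon m).Adj (i, k) b)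
    {k : ℕ} (h0 : 0 < k) (hk : (i, k) ∈ s) : ∀ j ≤ m, hexVertex m i j ∈ s := by
  obtain ⟨a, -, -, -, -, ha, -⟩ := hs k h0 hk
  have hkm := lt_of_hexagon_adj ha
  refine forall_mem_of_forall_interior (i₀ := k) ?_ h0 hkm (by rwa [hexVertex_of_lt hkm])
  intro j hj0 hj hjs
  rw [hexVertex_of_lt hj] at hjs
  exact mem_and_mem_of_two_neighbors (hs j hj0 hjs) fun z hz => hexagon_adj_inner hj0 hz

theorem forall_mem_of_core {s : Set (ZMod 6 × ℕ)} (hne : s.Nonempty)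
    (hs : ∀ y ∈ s, ∃ a ∈ s, ∃ b ∈ s, a ≠ b ∧ (hexagon m).Adj y a ∧ (hexagon m).Adj y b) :
    ∀ i, ∀ j ≤ m, hexVertex m i j ∈ s := by
  have hin : ∀ i k, 0 < k → (i, k) ∈ s → ∀ j ≤ m, hexVertex m i j ∈ s := fun i k h0 hk =>
    hexVertex_mem_of_inner (fun k _ hk => hs _ hk) h0 hk
  have hcorner : ∀ i, (i, 0) ∈ s → ∀ j ≤ m, hexVertex m i j ∈ s := by
    intro i hi
    have h1 := (mem_and_mem_of_two_neighbors (hs _ hi) fun z hz => hexagon_adj_corner hz).1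
    have hm : 0 < m := by
      obtain ⟨a, -, -, -, -, ha, -⟩ := hs _ hi
      exact lt_of_hexagon_adj ha
    rcases Nat.lt_or_ge 1 m with h | h
    · rw [hexVertex_of_lt h] at h1
      exact hin i 1 one_pos h1
    · obtain rfl : m = 1 := by omega
      intro j hj
      rcases Nat.le_one_iff_eq_zero_or_eq_one.1 hj with rfl | rfl
      · rwa [hexVertex_of_lt one_pos]
      · exact h1
  have hstep : ∀ i, (∀ j ≤ m, hexVertex m i j ∈ s) → ∀ j ≤ m, hexVertex m (i + 1) j ∈ s := by
    intro i h
    have := h m le_rfl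
    rw [hexVertex_self] at this
    exact hcorner _ this
  obtain ⟨⟨i, k⟩, hik⟩ := hne
  have h0 : ∀ j ≤ m, hexVertex m i j ∈ s := by
    rcases Nat.eq_zero_or_pos k with rfl | h
    · exact hcorner i hik
    · exact hin i k h hik
  have hd : ∀ d : ℕ, ∀ j ≤ m, hexVertex m (i + d) j ∈ s := by
    intro d
    induction d with
    | zero => simpa using h0
    | succ d ih =>
      have := hstep _ ih
      rwa [add_assoc, ← Nat.cast_succ] at this
  intro i'
  have := hd (i' - i).val
  rwa [ZMod.natCast_zmod_val, add_sub_cancel] at this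

theorem card_le_of_forall_mem (s : Finset (ZMod 6 × ℕ))
    (hs : ∀ i, ∀ j < m, (i, j) ∈ s) : 6 * m ≤ s.card := by
  have : (Finset.univ : Finset (ZMod 6)) ×ˢ Finset.range m ⊆ s := by
    rintro ⟨i, j⟩ h
    exact hs i j (by simpa using h)
  have h := Finset.card_le_card this
  rw [Finset.card_product, Finset.card_univ, ZMod.card, Finset.card_range] at h
  exact h

theorem coreBound_hexagon : (hexagon m).CoreBound (6 * m) := by
  intro s hne hs
  refine card_le_of_forall_mem s fun i j hj => ?_
  have := forall_mem_of_core (s := (s : Set (ZMod 6 × ℕ))) hne hs i j hj.le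
  rwa [hexVertex_of_lt hj] at this

/-- Here n = m: a side has m - 1 inner vertices, one more than a clean arc needs, so the arc can
avoid the corners. -/
theorem hexagon_hyperfreeOver_corners :
    (hexagon m).HyperfreeOver m {a | a.2 = 0} Set.univ := by
  intro s _ _ hne
  by_contra hcon
  push Not at hcon
  obtain ⟨hloose, harc⟩ := hcon
  obtain ⟨⟨i, k⟩, hik, hk⟩ := hne
  have hk : 0 < k := Nat.pos_of_ne_zero hk
  have hall := hexVertex_mem_of_inner (m := m) (s := s) (i := i) (by
    intro k h0 hk
    obtain ⟨a, ha, b, hb, hya, hyb, hab⟩ := hloose (i, k) ⟨hk, fun h => h0.ne' h⟩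
    exact ⟨a, ha, b, hb, hab, hya, hyb⟩) hk hik
  obtain ⟨j, h0, hj, h⟩ := harc (hexVertex m i)
    ((hexVertex_injOn i).mono fun j hj => Set.mem_Iic.2 (Set.mem_Iio.1 hj).le)
    (fun j hj => hall j hj.le) (fun j hj => hexagon_adj (by omega))
  have hjv : hexVertex m i j = (i, j) := hexVertex_of_lt (by omega)
  obtain ⟨z, -, hz, h1, h2⟩ := h (by rw [hjv]; exact h0.ne')
  rw [hjv] at hz
  rcases hexagon_adj_inner h0 hz with h | h
  · exact h1 h
  · exact h2 h

theorem hexagon_hyperfreeOver_empty_corners {n : ℕ} (hm : 2 ≤ m) :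
    (hexagon m).HyperfreeOver n ∅ {a | a.2 = 0} := by
  rintro s - hs ⟨⟨i, k⟩, hik, -⟩
  obtain rfl : k = 0 := hs hik
  refine Or.inl ⟨(i, 0), ⟨hik, Set.notMem_empty _⟩, fun a ha b _ hya _ => ?_⟩
  have h0 : a.2 = 0 := hs ha
  rcases hexagon_adj_corner hya with rfl | rfl
  · rw [hexVertex_of_lt (by omega)] at h0
    simp at h0
  · simp only at h0
    omega

theorem hexPath_of_le {j : ℕ} (h : j ≤ m) : hexPath m j = hexVertex m 0 j := if_pos h

theorem hexPath_succ_self : hexPath m (m + 1) = hexVertex m 1 1 := by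
  simp [hexPath]

theorem hexPath_self : hexPath m m = (1, 0) := by
  rw [hexPath_of_le le_rfl, hexVertex_self, zero_add]

theorem hexPath_adj (hm : 0 < m) {j : ℕ} (hj : j ≤ m) :
    (hexagon m).Adj (hexPath m j) (hexPath m (j + 1)) := by
  rcases hj.lt_or_eq with hj | rfl
  · rw [hexPath_of_le hj.le, hexPath_of_le hj]
    exact hexagon_adj hj
  · rw [hexPath_self, hexPath_succ_self, ← hexVertex_of_lt (i := 1) hm]
    exact hexagon_adj hm

theorem hexPath_injOn : Set.InjOn (hexPath m) (Set.Iic (m + 1)) := by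
  have key : ∀ j ≤ m, hexVertex m 0 j ≠ hexVertex m 1 1 := by
    intro j hj h
    have h' : ((if j < m then (0, j) else (0 + 1, 0)) : ZMod 6 × ℕ) =
      if 1 < m then (1, 1) else (1 + 1, 0) := h
    split_ifs at h' with h1 h2 h2
    · exact absurd (Prod.mk.inj h').1 (by decide)
    · exact absurd (Prod.mk.inj h').1 (by decide)
    · exact absurd (Prod.mk.inj h').2 (by decide)
    · exact absurd (Prod.mk.inj h').1 (by decide)
  intro j hj j' hj' h
  simp only [Set.mem_Iic] at hj hj'
  rcases Nat.le_or_eq_of_le_succ hj with h1 | rfl <;>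
    rcases Nat.le_or_eq_of_le_succ hj' with h2 | rfl
  · rw [hexPath_of_le h1, hexPath_of_le h2] at h
    exact hexVertex_injOn 0 h1 h2 h
  · rw [hexPath_of_le h1, hexPath_succ_self] at h
    exact absurd h (key j h1)
  · rw [hexPath_of_le h2, hexPath_succ_self] at h
    exact absurd h.symm (key j' h2)
  · rfl

/-- Here n = m + 2: a clean arc needs m inner vertices, one more than a side offers. The arc
`hexPath` therefore passes through the corner `(1, 0)`, which has valency 2 as long as nothing is
attached. -/
theorem hexagon_hyperfreeOver_empty (hm : 0 < m) :
    (hexagon m).HyperfreeOver (m + 2) ∅ Set.univ := by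
  intro s _ _ hne
  rw [Set.sdiff_empty] at hne
  by_contra hcon
  push Not at hcon
  obtain ⟨hloose, harc⟩ := hcon
  have hall := forall_mem_of_core (m := m) hne (by
    intro y hy
    obtain ⟨a, ha, b, hb, hya, hyb, hab⟩ := hloose y ⟨hy, Set.notMem_empty _⟩
    exact ⟨a, ha, b, hb, hab, hya, hyb⟩)
  obtain ⟨j, h0, hj, h⟩ := harc (hexPath m)
    (hexPath_injOn.mono fun j hj => Set.mem_Iic.2 (by have := Set.mem_Iio.1 hj; omega))
    (fun j hj => by
      unfold hexPath
      split_ifs with h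
      · exact hall 0 j h
      · exact hall 1 _ (by omega))
    (fun j hj => hexPath_adj hm (by omega))
  obtain ⟨z, -, hz, h1, h2⟩ := h (Set.notMem_empty _)
  rcases (show j ≤ m by omega).lt_or_eq with hjm | rfl
  · rw [hexPath_of_le (by omega), hexVertex_of_lt hjm] at hz
    rw [hexPath_of_le (by omega)] at h1 h2
    rcases hexagon_adj_inner h0 hz with h | h
    · exact h1 h
    · exact h2 h
  · rw [hexPath_self] at hz
    rw [hexPath_of_le (by omega), hexVertex_of_lt (by omega)] at h1
    rw [hexPath_succ_self] at h2
    rcases hexagon_adj_corner hz with h | h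
    · exact h2 h
    · exact h1 (by rw [h, sub_self])

end hexagon

end SimpleGraph

/-! ### Attaching a hexagon -/

namespace SimpleGraph

variable {U : Type*}

/-- The graph `H` with a hexagon attached, whose corners are joined to the vertices `x i`. -/
def attachHexagon (H : SimpleGraph U) (x : ZMod 6 → U) (m : ℕ) :
    SimpleGraph (U ⊕ (ZMod 6 × ℕ)) where
  Adj
    | .inl a, .inl b => H.Adj a b
    | .inr a, .inr b => (hexagon m).Adj a b
    | .inl a, .inr b => b.2 = 0 ∧ a = x b.1
    | .inr a, .inl b => a.2 = 0 ∧ b = x a.1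
  symm := ⟨by
    rintro (a | a) (b | b) h
    · exact H.adj_symm h
    · exact h
    · exact h
    · exact (hexagon m).adj_symm h⟩
  loopless := ⟨by
    rintro (a | a) h
    · exact H.irrefl h
    · exact (hexagon m).irrefl h⟩

section attachHexagon

variable {H : SimpleGraph U} {x : ZMod 6 → U} {m : ℕ}

/-- The inclusion of `H`. -/
def attachHexagonInl : H ↪g H.attachHexagon x m := ⟨Function.Embedding.inl, Iff.rfl⟩

/-- The inclusion of the hexagon. -/
def attachHexagonInr : hexagon m ↪g H.attachHexagon x m := ⟨Function.Embedding.inr, Iff.rfl⟩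

theorem attachHexagon_hyperfreeOver {n : ℕ} (h : H.HyperfreeOver n (Set.range x) Set.univ) :
    (H.attachHexagon x m).HyperfreeOver n (Set.range Sum.inr ∪ Sum.inl '' Set.range x)
      Set.univ := by
  rintro s hs - ⟨y, hy, hyX⟩
  have hX : ∀ u : U, (Sum.inl u : U ⊕ (ZMod 6 × ℕ)) ∈
      Set.range Sum.inr ∪ Sum.inl '' Set.range x ↔ u ∈ Set.range x := by simp
  have hinl : ∀ u ∉ Set.range x, ∀ z, (H.attachHexagon x m).Adj (.inl u) z → ∃ v, z = .inl v := by
    rintro u hu (v | v) h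
    · exact ⟨v, rfl⟩
    · exact absurd ⟨_, h.2.symm⟩ hu
  have hne : (Sum.inl ⁻¹' s \ Set.range x).Nonempty := by
    rcases y with y | y
    · exact ⟨y, hy, fun h => hyX ((hX y).2 h)⟩
    · exact absurd (Or.inl ⟨y, rfl⟩) hyX
  rcases h _ (hs.preimage Sum.inl_injective.injOn) (Set.subset_univ _) hne with
    ⟨y, hy, hl⟩ | ⟨p, hinj, hmem, hadj, hp⟩
  · refine Or.inl ⟨.inl y, ⟨hy.1, fun h => hy.2 ((hX y).1 h)⟩, ?_⟩
    intro a ha b hb hya hyb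
    obtain ⟨a, rfl⟩ := hinl y hy.2 a hya
    obtain ⟨b, rfl⟩ := hinl y hy.2 b hyb
    rw [hl a ha b hb hya hyb]
  · refine Or.inr ⟨Sum.inl ∘ p, Sum.inl_injective.comp_injOn hinj, hmem, hadj, ?_⟩
    intro i h0 hi
    refine ⟨fun h => (hp i h0 hi).1 ((hX _).1 h), ?_⟩
    intro z hz hpz
    obtain ⟨z, rfl⟩ := hinl _ (hp i h0 hi).1 z hpz
    exact ((hp i h0 hi).2 z hz hpz).imp (congrArg _) (congrArg _)

/-- Each `x i` sees a single hexagon vertex and no other `x j`, so it is a loose end. -/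
theorem attachHexagon_hyperfreeOver_range (hx : ∀ i j, ¬ H.Adj (x i) (x j))
    (hinj : Function.Injective x) {n : ℕ} :
    (H.attachHexagon x m).HyperfreeOver n (Set.range Sum.inr)
      (Set.range Sum.inr ∪ Sum.inl '' Set.range x) := by
  rintro s - hs ⟨y, hy, hyX⟩
  rcases hs hy with h | ⟨-, ⟨i, rfl⟩, rfl⟩
  · exact absurd h hyX
  have key : ∀ a ∈ s, (H.attachHexagon x m).Adj (.inl (x i)) a → a = .inr (i, 0) := by
    intro a ha h
    rcases hs ha with ⟨⟨j, k⟩, rfl⟩ | ⟨-, ⟨j, rfl⟩, rfl⟩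
    · obtain ⟨h0, h1⟩ := h
      obtain rfl : k = 0 := h0
      rw [hinj h1]
    · exact absurd h (hx i j)
  exact Or.inl ⟨_, ⟨hy, hyX⟩, fun a ha b hb hya hyb => (key a ha hya).trans (key b hb hyb).symm⟩

/-- The order of construction is changed: the hexagon comes first, then the `x i`, then the rest of
`H`, which is only required to be hyperfree over the `x i`. -/
theorem attachHexagon_hyperfreeOver_empty (hm : 0 < m) (hx : ∀ i j, ¬ H.Adj (x i) (x j))
    (hinj : Function.Injective x) (h : H.HyperfreeOver (m + 2) (Set.range x) Set.univ) :
    (H.attachHexagon x m).HyperfreeOver (m + 2) ∅ Set.univ := by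
  have h1 := (hexagon_hyperfreeOver_empty hm).image (attachHexagonInr (H := H) (x := x))
  rw [Set.image_empty, Set.image_univ] at h1
  exact (h1.trans (attachHexagon_hyperfreeOver_range hx hinj) (Set.empty_subset _)).trans
    (attachHexagon_hyperfreeOver h) (Set.empty_subset _)

/-- Count by the sides contained in a core. All six give 6m ≥ 2n vertices; for m = 1 this is an
equality, so fewer sides would not do. With at least two but not all, there are 2m + 1 = 2n - 3
hexagon vertices and three vertices of `H`. With one, there are m + 1 = n - 1 hexagon vertices, and
in `H` either a core or a walk between consecutive `x i`, which takes n + 1 vertices. With none, the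
core lies in `H`. -/
theorem attachHexagon_coreBound {n : ℕ} (hm : 0 < m) (hn : n = m + 2)
    (hx : ∀ i j, ¬ H.Adj (x i) (x j)) (hinj : Function.Injective x)
    (hfar : ∀ i, ∀ w : H.Walk (x i) (x (i + 1)), n ≤ w.length) (hH : H.CoreBound (2 * n)) :
    (H.attachHexagon x m).CoreBound (2 * n) := by
  classical
  intro s hne hs
  have hcard : s.toLeft.card + s.toRight.card = s.card := Finset.card_toLeft_add_card_toRight
  -- neighbours of the different kinds of vertices
  have hleft : ∀ u ∈ s.toLeft, (∀ i, u = x i → (i, 0) ∉ s.toRight) →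
      ∃ a ∈ s.toLeft, ∃ b ∈ s.toLeft, a ≠ b ∧ H.Adj u a ∧ H.Adj u b := by
    intro u hu hux
    have key : ∀ z ∈ s, (H.attachHexagon x m).Adj (.inl u) z → ∃ a ∈ s.toLeft, z = .inl a := by
      rintro (a | ⟨i, k⟩) hz h
      · exact ⟨a, Finset.mem_toLeft.2 hz, rfl⟩
      · obtain ⟨h0, h1⟩ := h
        obtain rfl : k = 0 := h0
        exact absurd (Finset.mem_toRight.2 hz) (hux i h1)
    obtain ⟨a, ha, b, hb, hab, hya, hyb⟩ := hs _ (Finset.mem_toLeft.1 hu)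
    obtain ⟨a, ha', rfl⟩ := key a ha hya
    obtain ⟨b, hb', rfl⟩ := key b hb hyb
    exact ⟨a, ha', b, hb', fun h => hab (congrArg _ h), hya, hyb⟩
  have hleft1 : ∀ i, x i ∈ s.toLeft → ∃ a ∈ s.toLeft, H.Adj (x i) a := by
    intro i hi
    have key : ∀ z ∈ s, (H.attachHexagon x m).Adj (.inl (x i)) z →
        (∃ a ∈ s.toLeft, H.Adj (x i) a) ∨ z = .inr (i, 0) := by
      rintro (a | ⟨j, k⟩) hz h
      · exact Or.inl ⟨a, Finset.mem_toLeft.2 hz, h⟩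
      · obtain ⟨h0, h1⟩ := h
        obtain rfl : k = 0 := h0
        rw [hinj h1]
        exact Or.inr rfl
    obtain ⟨a, ha, b, hb, hab, hya, hyb⟩ := hs _ (Finset.mem_toLeft.1 hi)
    rcases key a ha hya with h | rfl
    · exact h
    · rcases key b hb hyb with h | rfl
      · exact h
      · exact absurd rfl hab
  have hinner : ∀ i k, 0 < k → (i, k) ∈ s.toRight → ∀ j ≤ m, hexVertex m i j ∈ s.toRight := by
    intro i k h0 hk
    refine hexVertex_mem_of_inner (s := (s.toRight : Set (ZMod 6 × ℕ))) ?_ h0 hk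
    intro k h0 hk
    have key : ∀ z ∈ s, (H.attachHexagon x m).Adj (.inr (i, k)) z →
        ∃ a ∈ s.toRight, z = .inr a := by
      rintro (a | a) hz h
      · exact absurd h.1 h0.ne'
      · exact ⟨a, Finset.mem_toRight.2 hz, rfl⟩
    obtain ⟨a, ha, b, hb, hab, hya, hyb⟩ := hs _ (Finset.mem_toRight.1 hk)
    obtain ⟨a, ha', rfl⟩ := key a ha hya
    obtain ⟨b, hb', rfl⟩ := key b hb hyb
    exact ⟨a, ha', b, hb', fun h => hab (congrArg _ h), hya, hyb⟩
  let Side : ZMod 6 → Prop := fun i => ∀ j ≤ m, hexVertex m i j ∈ s.toRight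
  have hside : ∀ i, hexVertex m i 1 ∈ s.toRight → (i, 0) ∈ s.toRight → Side i := by
    intro i h1 h0
    rcases Nat.lt_or_ge 1 m with h | h
    · rw [hexVertex_of_lt h] at h1
      exact hinner i 1 one_pos h1
    · obtain rfl : m = 1 := by omega
      intro j hj
      rcases Nat.le_one_iff_eq_zero_or_eq_one.1 hj with rfl | rfl
      · rwa [hexVertex_of_lt one_pos]
      · exact h1
  have hside' : ∀ i, (i - 1, m - 1) ∈ s.toRight → (i, 0) ∈ s.toRight → Side (i - 1) := by
    intro i h1 h0
    rcases Nat.lt_or_ge 1 m with h | h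
    · exact hinner (i - 1) (m - 1) (by omega) h1
    · obtain rfl : m = 1 := by omega
      intro j hj
      rcases Nat.le_one_iff_eq_zero_or_eq_one.1 hj with rfl | rfl
      · rwa [hexVertex_of_lt one_pos]
      · rwa [hexVertex_self, sub_add_cancel]
  have hcorner : ∀ i, (i, 0) ∈ s.toRight →
      Side i ∧ Side (i - 1) ∨ x i ∈ s.toLeft ∧ (Side i ∨ Side (i - 1)) := by
    intro i hi
    have key : ∀ z ∈ s, (H.attachHexagon x m).Adj (.inr (i, 0)) z →
        z = .inl (x i) ∧ x i ∈ s.toLeft ∨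
        z = .inr (hexVertex m i 1) ∧ Side i ∨ z = .inr (i - 1, m - 1) ∧ Side (i - 1) := by
      rintro (a | a) hz h
      · left
        obtain rfl := h.2
        exact ⟨rfl, Finset.mem_toLeft.2 hz⟩
      · right
        rcases hexagon_adj_corner h with rfl | rfl
        · exact Or.inl ⟨rfl, hside i (Finset.mem_toRight.2 hz) hi⟩
        · exact Or.inr ⟨rfl, hside' i (Finset.mem_toRight.2 hz) hi⟩
    obtain ⟨a, ha, b, hb, hab, hya, hyb⟩ := hs _ (Finset.mem_toRight.1 hi)
    rcases key a ha hya with ⟨rfl, h1⟩ | ⟨rfl, h1⟩ | ⟨rfl, h1⟩ <;>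
      rcases key b hb hyb with ⟨rfl, h2⟩ | ⟨rfl, h2⟩ | ⟨rfl, h2⟩ <;>
      first | exact absurd rfl hab | tauto
  have hcl : ∀ i, Side i → (i, 0) ∈ s.toRight := fun i h => by
    have := h 0 hm.le
    rwa [hexVertex_of_lt hm] at this
  have hcr : ∀ i, Side i → (i + 1, 0) ∈ s.toRight := fun i h => by
    have := h m le_rfl
    rwa [hexVertex_self] at this
  have hmem : ∀ i, Side i → ∀ j < m, (i, j) ∈ s.toRight := fun i h j hj => by
    have := h j hj.le
    rwa [hexVertex_of_lt hj] at this
  by_cases hr : s.toRight.Nonempty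
  swap
  · rw [Finset.not_nonempty_iff_eq_empty] at hr
    have hl : s.toLeft.Nonempty := by
      rw [← Finset.card_pos]
      rw [hr, Finset.card_empty, add_zero] at hcard
      rw [hcard]
      exact hne.card_pos
    have := hH s.toLeft hl fun u hu => hleft u hu (by simp [hr])
    omega
  obtain ⟨i₀, hi₀⟩ : ∃ i, Side i := by
    obtain ⟨⟨i, k⟩, hik⟩ := hr
    rcases Nat.eq_zero_or_pos k with rfl | h0
    · rcases hcorner i hik with h | ⟨-, h | h⟩
      · exact ⟨i, h.1⟩
      · exact ⟨i, h⟩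
      · exact ⟨_, h⟩
    · exact ⟨i, hinner i k h0 hik⟩
  by_cases hall : ∀ i, Side i
  · have := card_le_of_forall_mem s.toRight fun i => hmem i (hall i)
    omega
  by_cases hone : ∃ i, Side i ∧ i ≠ i₀
  · obtain ⟨i₁, hi₁, hne01⟩ := hone
    have hright : 2 * m + 1 ≤ s.toRight.card := by
      -- The extra vertex is the far corner of side `i`, which is not counted with side `i'` if `i'`
      -- does not follow `i`. For two distinct sides this can be arranged by exchanging them.
      have key : ∀ i i' : ZMod 6, i ≠ i' → i + 1 ≠ i' → Side i → Side i' →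
          2 * m + 1 ≤ s.toRight.card := by
        intro i i' h1 h2 hi hi'
        have hsub : insert (i + 1, 0) (({i, i'} : Finset (ZMod 6)) ×ˢ Finset.range m) ⊆
            s.toRight := by
          intro z hz
          rcases Finset.mem_insert.1 hz with rfl | hz
          · exact hcr i hi
          · obtain ⟨h, hj⟩ := Finset.mem_product.1 hz
            rw [Finset.mem_range] at hj
            rcases Finset.mem_insert.1 h with h | h
            · have := hmem i hi z.2 hj
              rwa [← h] at this
            · have := hmem i' hi' z.2 hj
              rwa [← Finset.mem_singleton.1 h] at this
        have hc := Finset.card_le_card hsub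
        have hni : i + 1 ≠ i := (by decide : ∀ i : ZMod 6, i + 1 ≠ i) i
        rw [Finset.card_insert_of_notMem (by simp [hni, h2]), Finset.card_product,
          Finset.card_pair h1, Finset.card_range] at hc
        exact hc
      by_cases h : i₀ + 1 = i₁
      · refine key i₁ i₀ hne01 ?_ hi₁ hi₀
        rw [← h]
        exact (by decide : ∀ i : ZMod 6, i + 1 + 1 ≠ i) i₀
      · exact key i₀ i₁ hne01.symm h hi₀ hi₁
    -- Where a run of sides begins, the corner needs `x i` as its second neighbour. A neighbour of
    -- `x i` in the core and two neighbours of the latter are the three vertices of `H`.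
    obtain ⟨i, hi, hi'⟩ : ∃ i, Side i ∧ ¬ Side (i - 1) := by
      by_contra hcon
      push Not at hcon
      apply hall
      intro i
      have hd : ∀ d : ℕ, Side (i₀ - d) := by
        intro d
        induction d with
        | zero => simpa using hi₀
        | succ d ih =>
          have := hcon _ ih
          rwa [sub_sub, ← Nat.cast_succ] at this
      have := hd (i₀ - i).val
      rwa [ZMod.natCast_zmod_val, sub_sub_cancel] at this
    have hxi : x i ∈ s.toLeft := by
      rcases hcorner i (hcl i hi) with h | h
      · exact absurd h.2 hi'
      · exact h.1
    obtain ⟨w, hw, hxw⟩ := hleft1 i hxi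
    obtain ⟨a, ha, b, hb, hab, hwa, hwb⟩ := hleft w hw fun j hj => by
      rw [hj] at hxw
      exact absurd hxw (hx i j)
    have hthree : 2 < s.toLeft.card := Finset.two_lt_card.2 ⟨w, hw, a, ha, b, hb, hwa.ne, hwb.ne, hab⟩
    omega
  · push Not at hone
    have hright : m + 1 ≤ s.toRight.card := by
      have hsub : (Finset.range (m + 1)).image (hexVertex m i₀) ⊆ s.toRight := by
        intro z hz
        obtain ⟨j, hj, rfl⟩ := Finset.mem_image.1 hz
        exact hi₀ j (by simpa [Nat.lt_succ_iff] using hj)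
      have hc := Finset.card_le_card hsub
      rwa [Finset.card_image_of_injOn ((hexVertex_injOn i₀).mono fun j hj => by
        simpa [Nat.lt_succ_iff] using hj), Finset.card_range] at hc
    have hni : ∀ i : ZMod 6, i - 1 ≠ i ∧ i + 1 ≠ i := by decide
    have hu : x i₀ ∈ s.toLeft := by
      rcases hcorner i₀ (hcl _ hi₀) with h | h
      · exact absurd (hone _ h.2) (hni i₀).1
      · exact h.1
    have hv : x (i₀ + 1) ∈ s.toLeft := by
      rcases hcorner (i₀ + 1) (hcr _ hi₀) with h | h
      · exact absurd (hone _ h.1) (hni i₀).2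
      · exact h.1
    rcases exists_core_or_walk H s.toLeft hu hv (hleft1 _ hu) (by
      intro y hy hyu hyv
      refine hleft y hy fun i hyi hi => ?_
      rcases hcorner i hi with h | ⟨-, h | h⟩
      · exact hyu (by rw [hyi, hone i h.1])
      · exact hyu (by rw [hyi, hone i h])
      · have := hone _ h
        exact hyv (by rw [hyi, ← this, sub_add_cancel])) with ⟨t, ht, htne, htc⟩ | ⟨w, hw⟩
    · have := hH t htne htc
      have := Finset.card_le_card ht
      omega
    · have := hfar i₀ w
      omega

end attachHexagon

end SimpleGraph

/-! ### From core bounds and hyperfreeness to open generalized polygons -/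

namespace SimpleGraph

variable {V : Type*}

theorem HyperfreeOver.isOpenPolygon {G : SimpleGraph V} {n : ℕ} (hn : 0 < n)
    (h : G.HyperfreeOver n ∅ Set.univ) : G.IsOpenPolygon n := by
  intro s hs hne
  rcases h s hs (Set.subset_univ _) (by rwa [Set.sdiff_empty]) with
    ⟨y, hy, hl⟩ | ⟨x, hinj, hmem, hadj, hx⟩
  · refine Or.inl ⟨⟨y, hy.1⟩, Set.encard_le_one_iff.2 ?_⟩
    rintro ⟨a, ha⟩ ⟨b, hb⟩ hya hyb
    exact Subtype.ext (hl a ha b hb hya hyb)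
  · right
    -- Only indices below `n` matter; the other values are placeholders.
    let x' : ℕ → s := fun i => if hi : i < n then ⟨x i, hmem i hi⟩ else ⟨x 0, hmem 0 hn⟩
    have hx' : ∀ i < n, (x' i : V) = x i := fun i hi => by simp [x', hi]
    refine ⟨x', ?_, ?_, ?_⟩
    · intro i hi j hj hij
      have := congrArg Subtype.val hij
      rw [hx' i hi, hx' j hj] at this
      exact hinj hi hj this
    · intro i hi
      rw [induce_adj, hx' i (by omega), hx' (i + 1) hi]
      exact hadj i hi
    · intro i h0 hi
      have hne : x' (i - 1) ≠ x' (i + 1) := by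
        intro he
        have := congrArg Subtype.val he
        rw [hx' _ (by omega), hx' _ hi] at this
        have := hinj (Set.mem_Iio.2 (by omega)) (Set.mem_Iio.2 hi) this
        omega
      rw [← Set.encard_pair hne]
      congr 1
      ext ⟨z, hz⟩
      rw [mem_neighborSet, induce_adj, hx' i (by omega), Set.mem_insert_iff, Set.mem_singleton_iff,
        Subtype.ext_iff, Subtype.ext_iff, hx' _ (by omega), hx' _ hi]
      constructor
      · exact (hx i h0 hi).2 z hz
      · rintro (rfl | rfl)
        · have := hadj (i - 1) (by omega)
          rw [Nat.sub_add_cancel h0] at this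
          exact this.symm
        · exact hadj i hi

theorem IsBipartiteWith.of_color {G : SimpleGraph V} {col : V → Bool}
    (hcol : ∀ a b, G.Adj a b → col b = !col a) :
    G.IsBipartiteWith {a | col a = true} {a | col a = false} where
  disjoint := by
    rw [Set.disjoint_left]
    intro a ha hb
    exact Bool.noConfusion (ha.symm.trans hb)
  mem_of_adj a b h := by
    have := hcol a b h
    simp only [Set.mem_ofPred_eq]
    revert this
    cases col a <;> cases col b <;> simp

/-- The path `p` makes both bounds sharp. Its first n edges cannot be shortcut, as two paths of
different lengths and total length below 2n violate the girth. A girth above 2n would be at least 2n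
+ 2 by parity, and then all n + 1 edges could not be shortcut either, against the bound n on
distances. -/
theorem isGeneralizedPolygon_of_coreBound {G : SimpleGraph V} {n : ℕ} {col : V → Bool}
    (hcol : ∀ a b, G.Adj a b → col b = !col a) (hcore : G.CoreBound (2 * n))
    (hwalk : ∀ u v, ∃ w : G.Walk u v, w.length ≤ n) (hinf : ∀ u, (G.neighborSet u).Infinite)
    {p : ℕ → V} (hp : ∀ i ≤ n, G.Adj (p i) (p (i + 1))) (hpi : Set.InjOn p (Set.Iic (n + 1))) :
    G.IsGeneralizedPolygon n := by
  classical
  have hg := hcore.le_egirth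
  refine ⟨(IsBipartiteWith.of_color hcol).isBipartite, le_antisymm ?_ ?_, le_antisymm ?_ hg, ?_⟩
  · rw [ediam_le_iff]
    intro u v
    obtain ⟨w, hw⟩ := hwalk u v
    exact w.edist_le.trans (by exact_mod_cast hw)
  · by_contra! hlt
    have h1 : G.edist (p 0) (p n) < n := edist_le_ediam.trans_lt hlt
    obtain ⟨w, hw⟩ := exists_walk_of_edist_ne_top (h1.trans_le le_top).ne
    rw [← hw] at h1
    have h1 : w.length < n := by exact_mod_cast h1
    have hb := w.length_bypass_le_length
    obtain ⟨q, hq, hqp⟩ := exists_isPath_of_forall_adj p n (fun i hi => hp i hi.le)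
      (hpi.mono (Set.Iic_subset_Iic.2 (by omega)))
    have := length_eq_of_isPath_of_lt_egirth w.bypass_isPath hqp
      (lt_of_lt_of_le (by norm_cast; omega) hg)
    omega
  · by_contra! hlt
    have hge : ((2 * n + 2 : ℕ) : ℕ∞) ≤ G.egirth := by
      rw [SimpleGraph.le_egirth]
      intro a c hc
      have h1 : 2 * n < c.length := by exact_mod_cast hlt.trans_le (egirth_le_length hc)
      have h2 := c.color_eq hcol
      have h3 : c.length ≠ 2 * n + 1 := by
        intro h
        rw [h, Nat.bodd_succ, Nat.bodd_mul] at h2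
        revert h2
        cases col a <;> simp
      have h4 : 2 * n + 2 ≤ c.length := by omega
      exact_mod_cast h4
    obtain ⟨w, hw⟩ := hwalk (p 0) (p (n + 1))
    have hb := w.length_bypass_le_length
    obtain ⟨q, hq, hqp⟩ := exists_isPath_of_forall_adj p (n + 1) (fun i hi => hp i (by omega)) hpi
    have := length_eq_of_isPath_of_lt_egirth w.bypass_isPath hqp
      (lt_of_lt_of_le (by norm_cast; omega) hge)
    omega
  · intro v
    rw [(hinf v).encard_eq]
    exact le_top

/-- A hexagon with sides of length `m` is attached to the vertices `x i` in `G`. -/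
def HasHexagon (G : SimpleGraph V) (x : ZMod 6 → V) (m : ℕ) : Prop :=
  ∃ β : ZMod 6 × Fin m → V, Function.Injective β ∧
    (∀ a b : ZMod 6 × Fin m, (hexagon m).Adj (a.1, a.2) (b.1, b.2) → G.Adj (β a) (β b)) ∧
    ∀ i, ∀ b : ZMod 6 × Fin m, x i ≠ β b ∧ (b.1 = i → b.2.val = 0 → G.Adj (x i) (β b))

/-- Test hyperfreeness on the hexagon together with the `x i`. No hexagon vertex is a loose end, and
its corners have at least three neighbours. So the m inner vertices of a clean arc would lie inside
one side, which has only m - 1 inner vertices. Additional edges of `G` between these vertices do no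
harm. -/
theorem HyperfreeOver.not_hasHexagon {G : SimpleGraph V} {x : ZMod 6 → V} {m : ℕ} (hm : 0 < m)
    (h : G.HyperfreeOver (m + 2) (Set.range x) Set.univ) : ¬ G.HasHexagon x m := by
  rintro ⟨β, hβ, hadj, hx⟩
  obtain ⟨B, hB⟩ : ∃ B : ZMod 6 × ℕ → V, ∀ i (k : Fin m), B (i, k) = β (i, k) :=
    ⟨fun a => if h : a.2 < m then β (a.1, ⟨a.2, h⟩) else x 0, fun i k => by simp⟩
  have hB' : ∀ a : ZMod 6 × ℕ, (h : a.2 < m) → B a = β (a.1, ⟨a.2, h⟩) :=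
    fun a h => hB a.1 ⟨a.2, h⟩
  have hBinj : ∀ a b : ZMod 6 × ℕ, a.2 < m → b.2 < m → B a = B b → a = b := by
    intro a b ha hb hab
    rw [hB' a ha, hB' b hb] at hab
    have := hβ hab
    simp only [Prod.mk.injEq, Fin.mk.injEq] at this
    exact Prod.ext this.1 this.2
  have hBx : ∀ i, ∀ a : ZMod 6 × ℕ, a.2 < m → x i ≠ B a := fun i a ha => by
    rw [hB' a ha]; exact (hx i _).1
  have hBadj : ∀ a b : ZMod 6 × ℕ, (hexagon m).Adj a b → G.Adj (B a) (B b) := by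
    intro a b hab
    rw [hB' a (lt_of_hexagon_adj hab), hB' b (lt_of_hexagon_adj hab.symm)]
    exact hadj _ _ hab
  have hxB : ∀ i, G.Adj (B (i, 0)) (x i) := fun i => by
    rw [hB' (i, 0) hm]
    exact ((hx i _).2 rfl rfl).symm
  have hvlt : ∀ i k, (hexVertex m i k).2 < m := by
    intro i k
    unfold hexVertex
    split_ifs with h
    · exact h
    · exact hm
  have hBv : ∀ i, ∀ k < m, G.Adj (B (i, k)) (B (hexVertex m i (k + 1))) := by
    intro i k hk
    have := hBadj _ _ (hexagon_adj (i := i) hk)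
    rwa [hexVertex_of_lt hk] at this
  have hBp : ∀ i k, 0 < k → k < m → G.Adj (B (i, k)) (B (i, k - 1)) := by
    intro i k h0 hk
    have := hBv i (k - 1) (by omega)
    rw [Nat.sub_add_cancel h0, hexVertex_of_lt hk] at this
    exact this.symm
  have hBc : ∀ i, G.Adj (B (i, 0)) (B (i - 1, m - 1)) := by
    intro i
    have := hBv (i - 1) (m - 1) (by omega)
    rw [Nat.sub_add_cancel hm, hexVertex_self, sub_add_cancel] at this
    exact this.symm
  have hBne : ∀ i k, 0 < k → k < m → B (i, k - 1) ≠ B (hexVertex m i (k + 1)) := by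
    intro i k h0 hk he
    have h1 := hBinj _ _ (show k - 1 < m by omega) (hvlt _ _) he
    rw [← hexVertex_of_lt (show k - 1 < m by omega)] at h1
    have := hexVertex_injOn i (Set.mem_Iic.2 (by omega)) (Set.mem_Iic.2 (by omega)) h1
    omega
  have hBcne : ∀ i, B (hexVertex m i 1) ≠ B (i - 1, m - 1) := by
    intro i he
    have h1 := hBinj _ _ (hvlt _ _) (show m - 1 < m by omega) he
    have h2 := congrArg Prod.fst h1
    unfold hexVertex at h2
    split_ifs at h2
    · exact (by decide : ∀ i : ZMod 6, i ≠ i - 1) i h2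
    · exact (by decide : ∀ i : ZMod 6, i + 1 ≠ i - 1) i h2
  let s : Set V := Set.range β ∪ Set.range x
  have hBs : ∀ a : ZMod 6 × ℕ, a.2 < m → B a ∈ s := fun a ha => by
    rw [hB' a ha]; exact Or.inl ⟨_, rfl⟩
  have hxs : ∀ i, x i ∈ s := fun i => Or.inr ⟨i, rfl⟩
  have hsB : ∀ y ∈ s, y ∉ Set.range x → ∃ i, ∃ k < m, y = B (i, k) := by
    rintro y (⟨⟨i, k⟩, rfl⟩ | hy) hyx
    · exact ⟨i, k, k.2, (hB i k).symm⟩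
    · exact absurd hy hyx
  rcases h s ((Set.finite_range β).union (Set.finite_range x)) (Set.subset_univ _)
    ⟨B (0, 0), hBs _ hm, fun ⟨i, hi⟩ => hBx i _ hm hi⟩ with
    ⟨y, ⟨hy, hyx⟩, hl⟩ | ⟨p, hinj, hmem, hpadj, hp⟩
  · obtain ⟨i, k, hk, rfl⟩ := hsB y hy hyx
    rcases Nat.eq_zero_or_pos k with rfl | h0
    · exact hBx i _ (hvlt i 1) (hl _ (hxs i) _ (hBs _ (hvlt _ _)) (hxB i) (hBv i 0 hm))
    · exact hBne i k h0 hk (hl _ (hBs _ (show k - 1 < m by omega)) _ (hBs _ (hvlt _ _))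
        (hBp i k h0 hk) (hBv i k hk))
  · have hinner : ∀ l, 0 < l → l + 1 < m + 2 → ∃ i k, 0 < k ∧ k < m ∧ p l = B (i, k) := by
      intro l h0 hl
      obtain ⟨hlx, hnb⟩ := hp l h0 hl
      obtain ⟨i, k, hk, hpl⟩ := hsB _ (hmem l (by omega)) hlx
      refine ⟨i, k, Nat.pos_of_ne_zero ?_, hk, hpl⟩
      rintro rfl
      rw [hpl] at hnb
      have ha := hnb _ (hxs i) (hxB i)
      have hb := hnb _ (hBs _ (hvlt _ _)) (hBv i 0 hm)
      have hc := hnb _ (hBs _ (show m - 1 < m by omega)) (hBc i)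
      have hab := hBx i _ (hvlt i 1)
      have hac := hBx i (i - 1, m - 1) (show m - 1 < m by omega)
      have hbc := hBcne i
      rcases ha with ha | ha <;> rcases hb with hb | hb <;> rcases hc with hc | hc <;>
        first
          | exact hab (ha.trans hb.symm)
          | exact hac (ha.trans hc.symm)
          | exact hbc (hb.trans hc.symm)
    have hI : ∃ I : ℕ → ZMod 6, ∃ K : ℕ → ℕ, ∀ l, 0 < l → l + 1 < m + 2 →
        0 < K l ∧ K l < m ∧ p l = B (I l, K l) := by
      have : ∀ l, ∃ i k, 0 < l → l + 1 < m + 2 → 0 < k ∧ k < m ∧ p l = B (i, k) := by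
        intro l
        by_cases hl : 0 < l ∧ l + 1 < m + 2
        · obtain ⟨i, k, h⟩ := hinner l hl.1 hl.2
          exact ⟨i, k, fun _ _ => h⟩
        · exact ⟨0, 0, fun h0 h1 => absurd ⟨h0, h1⟩ hl⟩
      choose I K hIK using this
      exact ⟨I, K, hIK⟩
    obtain ⟨I, K, hIK⟩ := hI
    -- The next vertex of the arc is one of the two hexagon neighbours of the current one, and it is
    -- not a corner, so the arc stays on its side.
    have hstep : ∀ l, 0 < l → l + 2 < m + 2 → I (l + 1) = I l := by
      intro l h0 hl
      obtain ⟨hK0, hK, hpl⟩ := hIK l h0 (by omega)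
      obtain ⟨hK0', hK', hpl'⟩ := hIK (l + 1) (by omega) hl
      obtain ⟨hlx, hnb⟩ := hp l h0 (by omega)
      rw [hpl] at hnb
      have ha := hnb _ (hBs _ (show K l - 1 < m by omega)) (hBp (I l) (K l) hK0 hK)
      have hb := hnb _ (hBs _ (hvlt _ _)) (hBv (I l) (K l) hK)
      have hab := hBne (I l) (K l) hK0 hK
      have : p (l + 1) = B (I l, K l - 1) ∨ p (l + 1) = B (hexVertex m (I l) (K l + 1)) := by
        rcases ha with ha | ha
        · rcases hb with hb | hb
          · exact absurd (ha.trans hb.symm) hab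
          · exact Or.inr hb.symm
        · exact Or.inl ha.symm
      rw [hpl'] at this
      rcases this with h | h
      · exact congrArg Prod.fst (hBinj _ _ hK' (show K l - 1 < m by omega) h)
      · have := hBinj _ _ hK' (hvlt _ _) h
        rcases (hexVertex_eq_iff hK).1 this with h | h
        · exact h.2.1
        · omega
    have hconst : ∀ l, l < m → I (l + 1) = I 1 := by
      intro l
      induction l with
      | zero => intro _; rfl
      | succ l ih => intro hl; rw [hstep (l + 1) (by omega) (by omega), ih (by omega)]
    -- Pigeonhole: m inner vertices of the arc, but only the positions 1, …, m - 1 on the side.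
    obtain ⟨l, hl, l', hl', hne, he⟩ := Finset.exists_ne_map_eq_of_card_lt_of_maps_to
      (s := Finset.range m) (t := Finset.Ico 1 m) (f := fun l => K (l + 1))
      (by simp; omega) (by
        intro l hl
        obtain ⟨h1, h2, -⟩ := hIK (l + 1) (by omega) (by simp at hl; omega)
        exact Finset.mem_coe.2 (Finset.mem_Ico.2 ⟨h1, h2⟩))
    simp only [Finset.mem_range] at hl hl' he
    have h1 := (hIK (l + 1) (by omega) (by omega)).2.2
    have h2 := (hIK (l' + 1) (by omega) (by omega)).2.2
    rw [hconst l hl, he] at h1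
    rw [hconst l' hl'] at h2
    have := hinj (Set.mem_Iio.2 (by omega)) (Set.mem_Iio.2 (by omega)) (h1.trans h2.symm)
    omega

theorem not_hexagon_adj_corners {m : ℕ} (hm : 2 ≤ m) (i j : ZMod 6) :
    ¬ (hexagon m).Adj (i, 0) (j, 0) := by
  intro h
  rcases hexagon_adj_corner h with h | h
  · rw [hexVertex_of_lt (by omega)] at h
    exact absurd (congrArg Prod.snd h) (by simp)
  · have := congrArg Prod.snd h
    simp only at this
    omega

end SimpleGraph

/-! ### Coloured graphs as structures, and the two models -/

namespace OpenPolygon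

open FirstOrder.Language FirstOrder.Language.Structure

/-- The structure of a graph with a 2-colouring. -/
@[reducible] def coloredStructure {M : Type*} (G : SimpleGraph M) (col : M → Bool) :
    lang.Structure M where
  funMap f := f.elim
  RelMap r x := match r with
    | .point => col (x 0) = true
    | .line => col (x 0) = false
    | .adj => G.Adj (x 0) (x 1)

theorem isOpenGeneralizedPolygon_coloredStructure {M : Type*} {G : SimpleGraph M} {n : ℕ}
    {col : M → Bool} (hcol : ∀ a b, G.Adj a b → col b = !col a) (hG : G.IsGeneralizedPolygon n)
    (ho : G.IsOpenPolygon n) :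
    letI := coloredStructure G col
    IsOpenGeneralizedPolygon n M := by
  let := coloredStructure G col
  exact ⟨G, fun _ _ => Iff.rfl, SimpleGraph.IsBipartiteWith.of_color hcol, hG, ho⟩

theorem model_theory {n : ℕ} {M : Type} [lang.Structure M] (h : IsOpenGeneralizedPolygon n M) :
    M ⊨ theory n :=
  ⟨fun _ hφ => hφ M h⟩

/-- The embedding of structures given by an embedding of coloured graphs. -/
def coloredEmbedding {M N : Type*} {G : SimpleGraph M} {H : SimpleGraph N} {col : M → Bool}
    {col' : N → Bool} (e : G ↪g H) (he : ∀ a, col' (e a) = col a) :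
    letI := coloredStructure G col
    letI := coloredStructure H col'
    M ↪[lang] N :=
  letI := coloredStructure G col
  letI := coloredStructure H col'
  { e.toEmbedding with
    map_fun' := fun f => f.elim
    map_rel' := by
      rintro _ (_ | _ | _) x
      · change col' (e (x 0)) = true ↔ col (x 0) = true
        rw [he]
      · change col' (e (x 0)) = false ↔ col (x 0) = false
        rw [he]
      · exact e.map_adj_iff }

open Classical in
/-- The formula expressing that a hexagon is attached to the six variables. -/
noncomputable def hexagonFormula (m : ℕ) : lang.Formula (ZMod 6) :=
  Formula.iExs (ZMod 6 × Fin m)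
    ((Formula.iInf fun ab : (ZMod 6 × Fin m) × (ZMod 6 × Fin m) =>
        (if ab.1 = ab.2 then ⊤ else
          ∼((Term.var (Sum.inr ab.1)).equal (Term.var (Sum.inr ab.2)))) ⊓
        (if (SimpleGraph.hexagon m).Adj (ab.1.1, ab.1.2) (ab.2.1, ab.2.2) then
          adjSymb.formula₂ (Term.var (Sum.inr ab.1)) (Term.var (Sum.inr ab.2)) else ⊤)) ⊓
      Formula.iInf fun ib : ZMod 6 × (ZMod 6 × Fin m) =>
        ∼((Term.var (Sum.inl ib.1)).equal (Term.var (Sum.inr ib.2))) ⊓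
        (if ib.2.1 = ib.1 ∧ ib.2.2.val = 0 then
          adjSymb.formula₂ (Term.var (Sum.inl ib.1)) (Term.var (Sum.inr ib.2)) else ⊤))

theorem realize_hexagonFormula {M : Type*} (G : SimpleGraph M) (col : M → Bool) (m : ℕ)
    (x : ZMod 6 → M) :
    letI := coloredStructure G col
    (hexagonFormula m).Realize x ↔ G.HasHexagon x m := by
  let := coloredStructure G col
  have hadj : ∀ a b : M, RelMap adjSymb ![a, b] ↔ G.Adj a b := fun _ _ => Iff.rfl
  rw [hexagonFormula, Formula.realize_iExs]
  refine exists_congr fun β => ?_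
  simp only [Formula.realize_inf, Formula.realize_iInf]
  constructor
  · rintro ⟨h1, h2⟩
    refine ⟨fun a b hab => ?_, fun a b hab => ?_, fun i b => ⟨?_, fun hi hb => ?_⟩⟩
    · by_contra hne
      have := (h1 (a, b)).1
      rw [if_neg hne, Formula.realize_not, Formula.realize_equal] at this
      exact this hab
    · have := (h1 (a, b)).2
      rw [if_pos hab, Formula.realize_rel₂, hadj] at this
      exact this
    · have := (h2 (i, b)).1
      rw [Formula.realize_not, Formula.realize_equal] at this
      exact this
    · have := (h2 (i, b)).2
      rw [if_pos ⟨hi, hb⟩, Formula.realize_rel₂, hadj] at this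
      exact this
  · rintro ⟨h1, h2, h3⟩
    refine ⟨fun ab => ⟨?_, ?_⟩, fun ib => ⟨?_, ?_⟩⟩
    · split_ifs with h
      · exact Formula.realize_top.2 trivial
      · rw [Formula.realize_not, Formula.realize_equal]
        exact fun he => h (h1 he)
    · split_ifs with h
      · rw [Formula.realize_rel₂, hadj]
        exact h2 ab.1 ab.2 h
      · exact Formula.realize_top.2 trivial
    · rw [Formula.realize_not, Formula.realize_equal]
      exact (h3 ib.1 ib.2).1
    · split_ifs with h
      · rw [Formula.realize_rel₂, hadj]
        exact (h3 ib.1 ib.2).2 h.1 h.2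
      · exact Formula.realize_top.2 trivial

/-- There is an embedding of open generalized `n`-gons and a tuple such that a hexagon is attached
to the tuple in the larger one only. -/
theorem exists_embedding_hexagon {n m : ℕ} (hm : 0 < m) (hn : n = m + 2) :
    ∃ (M N : Type) (G : SimpleGraph M) (H : SimpleGraph N) (col : M → Bool) (col' : N → Bool)
      (e : G ↪g H) (x : ZMod 6 → M),
      (∀ a b, G.Adj a b → col b = !col a) ∧ (∀ a b, H.Adj a b → col' b = !col' a) ∧
      (∀ a, col' (e a) = col a) ∧ G.IsGeneralizedPolygon n ∧ G.IsOpenPolygon n ∧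
      H.IsGeneralizedPolygon n ∧ H.IsOpenPolygon n ∧
      ¬ G.HasHexagon x m ∧ H.HasHexagon (e ∘ x) m := by
  classical
  have h3 : 3 ≤ n := by omega
  obtain ⟨G, col, hGadj, hGc, hGcol, hGcore, hGwalk, hGinf, hGfree⟩ :=
    -- Sides of length `n` are long enough to contain clean arcs avoiding the corners and to keep
    -- consecutive corners at distance at least `n`.
    SimpleGraph.exists_completion h3 (SimpleGraph.hexagon n) (SimpleGraph.hexColor n)
      (fun a b h => SimpleGraph.hexColor_adj h)
      (fun s hne hs => (SimpleGraph.coreBound_hexagon s hne hs).trans' (by omega))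
  let ι : SimpleGraph.hexagon n ↪g G := ⟨Function.Embedding.inl, hGadj _ _⟩
  let x : ZMod 6 → SimpleGraph.Completion (ZMod 6 × ℕ) := fun i => Sum.inl (i, 0)
  have hxinj : Function.Injective x := fun i j h => (Prod.mk.inj (Sum.inl_injective h)).1
  have hxadj : ∀ i j, ¬ G.Adj (x i) (x j) := fun i j h =>
    SimpleGraph.not_hexagon_adj_corners (by omega) i j ((hGadj _ _).1 h)
  have hcorners : ι '' {a | a.2 = 0} = Set.range x := by
    ext z
    constructor
    · rintro ⟨⟨i, k⟩, rfl : k = 0, rfl⟩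
      exact ⟨i, rfl⟩
    · rintro ⟨i, rfl⟩
      exact ⟨(i, 0), rfl, rfl⟩
  have hGx : G.HyperfreeOver n (Set.range x) Set.univ := by
    have h1 := (SimpleGraph.hexagon_hyperfreeOver_corners (m := n)).image ι
    rw [hcorners, Set.image_univ] at h1
    exact h1.trans hGfree (by rintro _ ⟨i, rfl⟩; exact ⟨_, rfl⟩)
  have hG0 : G.HyperfreeOver n ∅ Set.univ := by
    have h1 := (SimpleGraph.hexagon_hyperfreeOver_empty_corners (m := n) (n := n)
      (by omega)).image ι
    rw [hcorners, Set.image_empty] at h1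
    exact h1.trans hGx (Set.empty_subset _)
  have hGg := hGcore.le_egirth
  have hfar : ∀ i, ∀ w : G.Walk (x i) (x (i + 1)), n ≤ w.length := by
    intro i w
    by_contra! hlt
    obtain ⟨q, hq, hqp⟩ := SimpleGraph.exists_isPath_of_forall_adj
      (fun k => ι (SimpleGraph.hexVertex n i k)) n
      (fun k hk => ι.map_adj_iff.2 (SimpleGraph.hexagon_adj hk))
      (ι.injective.comp_injOn (SimpleGraph.hexVertex_injOn i))
    have e0 : ι (SimpleGraph.hexVertex n i 0) = x i := by
      rw [SimpleGraph.hexVertex_of_lt (by omega)]; rfl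
    have e1 : ι (SimpleGraph.hexVertex n i n) = x (i + 1) := by
      rw [SimpleGraph.hexVertex_self]; rfl
    have hb := w.length_bypass_le_length
    have := SimpleGraph.length_eq_of_isPath_of_lt_egirth (q := q.copy e0 e1)
      w.bypass_isPath (by simpa using hqp)
      (lt_of_lt_of_le (by rw [SimpleGraph.Walk.length_copy]; norm_cast; omega) hGg)
    rw [SimpleGraph.Walk.length_copy] at this
    omega
  -- The small hexagon gets the opposite colours because its corners are adjacent to the `x i`; on
  -- corners, `hexColor n` and `hexColor m` agree since n and m have the same parity.
  let colW : SimpleGraph.Completion (ZMod 6 × ℕ) ⊕ (ZMod 6 × ℕ) → Bool :=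
    Sum.elim col fun b => !SimpleGraph.hexColor m b
  have hcx : ∀ i, col (x i) = SimpleGraph.hexColor m (i, 0) := by
    intro i
    rw [hGc, hn]
    simp [SimpleGraph.hexColor, Nat.bodd_succ]
  have hWcol : ∀ a b, (G.attachHexagon x m).Adj a b → colW b = !colW a := by
    rintro (a | a) (b | ⟨j, k⟩) h
    · exact hGcol a b h
    · obtain ⟨h0, rfl⟩ := h
      obtain rfl : k = 0 := h0
      simp [colW, hcx]
    · obtain ⟨i, k⟩ := a
      obtain ⟨h0, rfl⟩ := h
      obtain rfl : k = 0 := h0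
      simp [colW, hcx]
    · simp only [colW, Sum.elim_inr, SimpleGraph.hexColor_adj h]
  obtain ⟨H, col', hHadj, hHc, hHcol, hHcore, hHwalk, hHinf, hHfree⟩ :=
    SimpleGraph.exists_completion h3 (G.attachHexagon x m) colW hWcol
      (SimpleGraph.attachHexagon_coreBound hm hn hxadj hxinj hfar hGcore)
  let κ : G.attachHexagon x m ↪g H := ⟨Function.Embedding.inl, hHadj _ _⟩
  let e : G ↪g H := SimpleGraph.attachHexagonInl.trans κ
  have hH0 : H.HyperfreeOver n ∅ Set.univ := by
    subst hn
    have h1 := (SimpleGraph.attachHexagon_hyperfreeOver_empty hm hxadj hxinj hGx).image κ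
    rw [Set.image_empty, Set.image_univ] at h1
    exact h1.trans hHfree (Set.empty_subset _)
  have hpadj : ∀ i ≤ n, G.Adj (ι (SimpleGraph.hexPath n i)) (ι (SimpleGraph.hexPath n (i + 1))) :=
    fun i hi => ι.map_adj_iff.2 (SimpleGraph.hexPath_adj (by omega) hi)
  have hpinj : Set.InjOn (fun i => ι (SimpleGraph.hexPath n i)) (Set.Iic (n + 1)) :=
    ι.injective.comp_injOn SimpleGraph.hexPath_injOn
  refine ⟨_, _, G, H, col, col', e, x, hGcol, hHcol, fun a => hHc _,
    SimpleGraph.isGeneralizedPolygon_of_coreBound hGcol hGcore hGwalk hGinf hpadj hpinj,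
    hG0.isOpenPolygon (by omega),
    SimpleGraph.isGeneralizedPolygon_of_coreBound hHcol hHcore hHwalk hHinf
      (p := fun i => e (ι (SimpleGraph.hexPath n i)))
      (fun i hi => e.map_adj_iff.2 (hpadj i hi)) (e.injective.comp_injOn hpinj),
    hH0.isOpenPolygon (by omega), ?_, ?_⟩
  · subst hn
    exact hGx.not_hasHexagon hm
  · refine ⟨fun b => κ (Sum.inr (b.1, b.2)), ?_, ?_, ?_⟩
    · rintro ⟨i, k⟩ ⟨j, l⟩ h
      have := Prod.mk.inj (Sum.inr_injective (κ.injective h))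
      exact Prod.ext this.1 (Fin.ext this.2)
    · intro a b h
      exact κ.map_adj_iff.2 h
    · rintro i ⟨j, k⟩
      refine ⟨fun h => Sum.inl_ne_inr (κ.injective h), ?_⟩
      rintro rfl h0
      exact κ.map_adj_iff.2 ⟨h0, rfl⟩

end OpenPolygon

/-! ### Failure of model completeness and quantifier elimination -/

theorem mainTheorem11 (n : ℕ) (hn : 3 ≤ n) :
    ¬ (OpenPolygon.theory n).IsModelComplete ∧
      ¬ (OpenPolygon.theory n).HasQuantifierElimination := by
  obtain ⟨M, N, G, H, col, col', e, x, hG, hH, hc, hGp, hGo, hHp, hHo, hGh, hHh⟩ :=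
    OpenPolygon.exists_embedding_hexagon (n := n) (m := n - 2) (by omega) (by omega)
  let : OpenPolygon.lang.Structure M := OpenPolygon.coloredStructure G col
  let : OpenPolygon.lang.Structure N := OpenPolygon.coloredStructure H col'
  have hM : M ⊨ OpenPolygon.theory n := OpenPolygon.model_theory
    (OpenPolygon.isOpenGeneralizedPolygon_coloredStructure hG hGp hGo)
  have hN : N ⊨ OpenPolygon.theory n := OpenPolygon.model_theory
    (OpenPolygon.isOpenGeneralizedPolygon_coloredStructure hH hHp hHo)
  have : Nonempty M := ⟨x 0⟩
  have : Nonempty N := ⟨e (x 0)⟩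
  let f : M ↪[OpenPolygon.lang] N := OpenPolygon.coloredEmbedding e hc
  have h1 : ¬ (OpenPolygon.hexagonFormula (n - 2)).Realize (M := M) x := fun h =>
    hGh ((OpenPolygon.realize_hexagonFormula G col _ x).1 h)
  have h2 : (OpenPolygon.hexagonFormula (n - 2)).Realize (M := N) (f ∘ x) :=
    (OpenPolygon.realize_hexagonFormula H col' _ (e ∘ x)).2 hHh
  constructor
  · intro hmc
    -- `ZMod 6` unfolds to `Fin 6`, so the corner-indexed tuple is a 6-tuple.
    exact h1 ((hmc (Language.Theory.ModelType.of _ M) (Language.Theory.ModelType.of _ N) f 6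
      (OpenPolygon.hexagonFormula (n - 2)) x).1 h2)
  · intro hqe
    obtain ⟨ψ, hψ, hiff⟩ := hqe 6 (OpenPolygon.hexagonFormula (n - 2))
    have hM' := Language.Formula.realize_iff.1 (hiff.realize_formula M (v := x))
    have hN' := Language.Formula.realize_iff.1 (hiff.realize_formula N (v := f ∘ x))
    refine h1 (hM'.2 ?_)
    have h3 := hN'.1 h2
    -- The embedding reflects the quantifier-free `ψ`, which would bring the hexagon down to the
    -- smaller model.
    have h4 := hψ.realize_embedding f (v := x) (xs := default)
    rw [Subsingleton.elim (f ∘ (default : Fin 0 → M)) default] at h4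
    exact h4.1 h3
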